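/- Let $X$ be a finite set, let $M(X)=\mathbb N^{X}$ be the free abelian monoid on $X$ (whose elements $f$ are identified with the monomials $x^f$), and let $I\subseteq M(X)$ be a monomial ideal, that is, an ideal of the monoid $M(X)$. Let $G_I$ be the group of all automorphisms of the monoid $M(X)$ that preserve $I$. For a field $\Bbbk'$ write $R'=\Bbbk'[X]$ with its standard $\mathbb Z$-grading, $\mathfrak m$ for the ideal of $R'$ generated by the variables, and $IR'$ for the ideal of $R'$ generated by the monomials $x^f$, $f\in I$. Let $\Bbbk'$ be a field extension of a field $\Bbbk$. A *symmetric minimal free resolution of $I$ over $\Bbbk'/\Bbbk$* consists of an action of $G_I$ on $\Bbbk'$ by field automorphisms over $\Bbbk$ (so that $\sigma\in G_I$ acts on $R'$ by $\sigma(c\,x^f)=\sigma(c)\,x^{\sigma(f)}$), a chain complex $$\mathfrak M:\quad 0\leftarrow M_0\xleftarrow{\mu_1} M_1\xleftarrow{\mu_2} M_2\leftarrow\cdots$$ of finitely generated free $R'$-modules with $H_n(\mathfrak M)=0$ and $\mu_n(M_n)\subseteq\mathfrak m M_{n-1}$ for all $n\ge 1$, and a group homomorphism $\sigma\mapsto\mathfrak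 M(\sigma)$ from $G_I$ to the group of automorphisms of $\mathfrak M$ as a complex of $\Bbbk$-vector spaces, such that: 1. there are integers $\beta_{n,d}\ge 0$ and $R'$-module isomorphisms $\theta_n\colon M_n\to\bigoplus_{d\in\mathbb Z}R'(-d)^{\beta_{n,d}}$ for $n\ge 0$ and $\epsilon\colon H_0(\mathfrak M)\to IR'$ such that all maps $\theta_{n-1}\mu_n\theta_n^{-1}$, $n\ge 1$, preserve degrees, and so does $\epsilon$ for the $\mathbb Z$-grading induced on $H_0(\mathfrak M)$ by $\theta_0$; 2. $\mathfrak M(\sigma)(rm)=\sigma(r)\,\mathfrak M(\sigma)(m)$ for all $\sigma\in G_I$, $r\in R'$ and $m\in M_n$, $n\ge 0$, and there is an $R'$-module isomorphism $\delta\colon H_0(\mathfrak M)\to IR'$ such that $\sigma\delta=\delta\bar\sigma$ for every $\sigma\in G_I$, where $\bar\sigma$ is the map induced by $\mathfrak M(\sigma)$ on $H_0(\mathfrak M)$. Let $L'$ be the set of all monomials $a\neq 1$ that are least common multiples of finite sets of minimal generators of $I$, ordered by divisibility, and let $\Delta$ be the order complex of $L'$. For $a\in L'$ and a field $\mathbb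 F$, let $C_\bullet(a)=C_\bullet(\Delta_{\le a},\Delta_{<a};\mathbb F)$, with differentials $d_n$, be the simplicial chain complex of the pair formed by the subcomplexes of all chains in $L'$ with largest element $\le a$, respectively $<a$. The chains $a_0<\dots<a_n=a$ in $L'$ give the canonical basis of $C_n(a)$. For each $n\ge 0$ choose a subset $X_n$ of the canonical basis of $C_n(a)$ that $d_n$ maps bijectively onto a basis of $\operatorname{im}d_n$. For a canonical basis element $b\notin X_n$ let $z(b)=b-\sum_{c\in X_n}r_c c$ be the cycle for which $d_n(b)=\sum_{c\in X_n}r_c d_n(c)$, and choose a subset $Z_n$ of these cycles that maps bijectively onto a basis of $H_n(C_\bullet(a))$. The *matroidal splitting* of $C_\bullet(a)$ induced by these choices is the chain homotopy $D=(D_n\colon C_n(a)\to C_{n+1}(a))_{n\ge 0}$ of linear maps such that, for every $n\ge 0$, $D_n$ vanishes on $X_n$ and on $Z_n$ and $D_n(d_{n+1}(b))=b$ for all $b\in X_{n+1}$. For a field $\Bbbk$ let $m(a)$ be the number of all (distinct) matroidal splittings of $C_\bullet(a)$ over the prime field $\mathbb F$ of $\Bbbk$, and call $a$ *critical over $\Bbbk$*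 if the characteristic of $\Bbbk$ divides $m(a)$. **Corollary.** For every monomial ideal $I$ in $M(X)$ there is an integer $N$ (depending on $I$) such that for every prime $p\ge N$ there is a symmetric minimal free resolution of $I$ over $\Bbbk'/\Bbbk$ with $\Bbbk'=\Bbbk=\mathbb F_p$. Moreover, for every prime $p\ge N$ and with $\Bbbk=\mathbb F_p$, one has $p>m(a)$ for all $a\in L'$, and no $a\in L'$ is critical over $\mathbb F_p$. -/

import Mathlib

universe u v w

/-! ### Monomial ideals and their symmetries

The free abelian monoid `M(X)` on a set `X` is `X →₀ ℕ`, written additively and ordered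
componentwise; `f` stands for the monomial `x^f`.  A monomial ideal in `M(X)` is an
`AddSemigroupIdeal (X →₀ ℕ)`. -/

namespace MonomialRes

noncomputable section

section Symmetry

variable {X : Type u}

/-- The group `G_I` of all automorphisms of the monoid `M(X)` that preserve the monomial ideal
`I`; the group law is composition. -/
def symGroup (I : AddSemigroupIdeal (X →₀ ℕ)) : Subgroup (Equiv.Perm (X →₀ ℕ)) where
  carrier := {γ | (∀ f g, γ (f + g) = γ f + γ g) ∧ ∀ f, γ f ∈ I ↔ f ∈ I}
  one_mem' := ⟨fun _ _ => rfl, fun _ => Iff.rfl⟩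
  mul_mem' := by
    rintro a b ⟨ha, ha'⟩ ⟨hb, hb'⟩
    refine ⟨fun f g => ?_, fun f => ?_⟩
    · rw [Equiv.Perm.mul_apply, Equiv.Perm.mul_apply, Equiv.Perm.mul_apply, hb, ha]
    · rw [Equiv.Perm.mul_apply, ha', hb']
  inv_mem' := by
    rintro a ⟨ha, ha'⟩
    refine ⟨fun f g => ?_, fun f => ?_⟩
    · apply a.injective
      rw [ha]
      simp only [← Equiv.Perm.mul_apply, mul_inv_cancel, Equiv.Perm.one_apply]
    · rw [← ha', ← Equiv.Perm.mul_apply, mul_inv_cancel, Equiv.Perm.one_apply]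

variable (K : Type v) [Field K]

/-- The ideal `I K[X]` of the polynomial ring `K[X]` generated by a monomial ideal `I`. -/
def polyIdeal (I : AddSemigroupIdeal (X →₀ ℕ)) : Ideal (MvPolynomial X K) :=
  Ideal.span ((fun f : X →₀ ℕ => MvPolynomial.monomial f (1 : K)) '' (I : Set (X →₀ ℕ)))

/-- The homogeneous maximal ideal of `K[X]`, generated by the variables. -/
def irrelevantIdeal (X : Type u) : Ideal (MvPolynomial X K) :=
  Ideal.span (Set.range MvPolynomial.X)

variable {K} {k : Type w} [Field k] [Algebra k K]

/-- The ring endomorphism of `K[X]` which acts on coefficients through the field automorphism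
`α` and on variables through `γ`.  For an automorphism `γ` of the monoid `M(X)` it sends
`c x^f` to `α(c) x^{γ(f)}`, see `polyMap_monomial`. -/
def polyMap (α : K ≃ₐ[k] K) (γ : Equiv.Perm (X →₀ ℕ)) :
    MvPolynomial X K →+* MvPolynomial X K :=
  MvPolynomial.eval₂Hom (MvPolynomial.C.comp (α : K →+* K))
    (fun x => MvPolynomial.monomial (γ (Finsupp.single x 1)) 1)

theorem polyMap_monomial (α : K ≃ₐ[k] K) (γ : Equiv.Perm (X →₀ ℕ))
    (hγ : ∀ f g, γ (f + g) = γ f + γ g) (f : X →₀ ℕ) (c : K) :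
    polyMap α γ (MvPolynomial.monomial f c) = MvPolynomial.monomial (γ f) (α c) := by
  let γ' : (X →₀ ℕ) →+ (X →₀ ℕ) := 
    { toFun := γ
      map_zero' := by
        have h := hγ 0 0
        rw [add_zero] at h
        exact left_eq_add.mp h
      map_add' := hγ }
  have key : ∀ g : X →₀ ℕ, γ g = g.sum fun x n => n • γ (Finsupp.single x 1) := by
    intro g
    change γ' g = g.sum fun x n => n • γ' (Finsupp.single x 1)
    conv_lhs => rw [← Finsupp.sum_single g]
    rw [map_finsuppSum]
    refine Finsupp.sum_congr fun x _ => ?_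
    rw [← map_nsmul, Finsupp.smul_single, smul_eq_mul, mul_one]
  rw [polyMap, MvPolynomial.coe_eval₂Hom, MvPolynomial.eval₂_monomial]
  simp only [MvPolynomial.monomial_pow, one_pow]
  rw [key f, MvPolynomial.monomial_finsupp_sum_index]
  rfl

end Symmetry

/-! ### Twisted graded free modules -/

section Graded

variable {X : Type u} {K : Type v} [Field K]

/-- `q` lies in the component of degree `e` of `K[X]` with its standard `ℤ`-grading (which is
zero for `e < 0`). -/
def IsZHomogeneous (q : MvPolynomial X K) (e : ℤ) : Prop :=
  ∀ f : X →₀ ℕ, MvPolynomial.coeff f q ≠ 0 → (f.degree : ℤ) = e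

variable (X K) in
/-- The module `⨁_d K[X](-d)^{β_d}`. -/
abbrev TwistedFree (β : ℤ → ℕ) : Type (max u v) :=
  ((d : ℤ) × Fin (β d)) →₀ MvPolynomial X K

/-- `h` lies in the component of degree `e` of `⨁_d K[X](-d)^{β_d}`, where `S(-d)_e = S_{e-d}`. -/
def TwistedFree.IsHomogeneous {β : ℤ → ℕ} (h : TwistedFree X K β) (e : ℤ) : Prop :=
  ∀ i, IsZHomogeneous (h i) (e - i.1)

end Graded

/-! ### The symmetric minimal free resolution problem -/

/-- A solution, over the field extension `K` of `k`, of the problem of constructing a minimal free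
resolution of the monomial ideal `I` which respects the symmetries of `I`.  The chain complex is
`0 ← M 0 ← M 1 ← ⋯` with differential `μ n : M (n + 1) → M n`, so that its homology in degree `0`
is `M 0 ⧸ range (μ 0)`. -/
structure SymMinRes (k : Type w) (K : Type v) [Field k] [Field K] [Algebra k K] {X : Type u}
    (I : AddSemigroupIdeal (X →₀ ℕ)) where
  /-- the action of `G_I` as field automorphisms of `K` over `k` -/
  fieldAct : symGroup I →* (K ≃ₐ[k] K)
  /-- the components of the complex -/
  M : ℕ → Type (max u v)
  [instAddCommGroup : ∀ n, AddCommGroup (M n)]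
  [instModule : ∀ n, Module (MvPolynomial X K) (M n)]
  [instModuleBase : ∀ n, Module k (M n)]
  [instTower : ∀ n, IsScalarTower k (MvPolynomial X K) (M n)]
  [instFree : ∀ n, Module.Free (MvPolynomial X K) (M n)]
  [instFinite : ∀ n, Module.Finite (MvPolynomial X K) (M n)]
  /-- the differential -/
  μ : ∀ n, M (n + 1) →ₗ[MvPolynomial X K] M n
  /-- a complex without homology in positive degrees -/
  acyclic : ∀ n, Function.Exact (μ (n + 1)) (μ n)
  /-- `μ_n (M_n) ⊆ 𝔪 M_{n-1}` -/
  minimal : ∀ n, LinearMap.range (μ n) ≤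
    irrelevantIdeal K X • (⊤ : Submodule (MvPolynomial X K) (M n))
  /-- a group homomorphism from `G_I` to the `k`-automorphisms of the complex -/
  act : symGroup I →* (∀ n, M n ≃ₗ[k] M n)
  act_comm : ∀ σ n x, μ n (act σ (n + 1) x) = act σ n (μ n x)
  /-- The complex is isomorphic to a graded one with zeroth homology `I K[X]`. -/
  graded : ∃ (β : ℕ → ℤ → ℕ)
      (θ : ∀ n, M n ≃ₗ[MvPolynomial X K] TwistedFree X K (β n))
      (ε : (M 0 ⧸ LinearMap.range (μ 0)) ≃ₗ[MvPolynomial X K] polyIdeal K I),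
    (∀ n e, ∀ h : TwistedFree X K (β (n + 1)), h.IsHomogeneous e →
      (θ n (μ n ((θ (n + 1)).symm h))).IsHomogeneous e) ∧
    (∀ e, ∀ h : TwistedFree X K (β 0), h.IsHomogeneous e →
      IsZHomogeneous (ε (Submodule.Quotient.mk ((θ 0).symm h)) : MvPolynomial X K) e)
  /-- `act σ` is `K[X]`-linear as a map from the complex to its restriction along `σ`. -/
  act_smul : ∀ σ n (r : MvPolynomial X K) (x : M n),
    act σ n (r • x) = polyMap (fieldAct σ) (σ : Equiv.Perm (X →₀ ℕ)) r • act σ n x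
  /-- On zeroth homology, `act σ` is the action of `σ` on `I K[X]`. -/
  equivariant : ∃ δ : (M 0 ⧸ LinearMap.range (μ 0)) ≃ₗ[MvPolynomial X K] polyIdeal K I,
    ∀ σ (x : M 0), (δ (Submodule.Quotient.mk (act σ 0 x)) : MvPolynomial X K) =
      polyMap (fieldAct σ) (σ : Equiv.Perm (X →₀ ℕ)) (δ (Submodule.Quotient.mk x))

/-! ### The lcm-lattice and its strata -/

section Lattice

variable {X : Type u} (I : AddSemigroupIdeal (X →₀ ℕ))

/-- The set of minimal generators of `I`. -/
def minGens : Set (X →₀ ℕ) := {f | Minimal (fun g => g ∈ I) f}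

/-- The lcm-lattice of `I`: the least common multiples of finite sets of minimal generators. -/
def lcmLattice : Set (X →₀ ℕ) :=
  {a | ∃ S : Finset (X →₀ ℕ), (S : Set (X →₀ ℕ)) ⊆ minGens I ∧ S.sup id = a}

/-- The lcm-lattice without its least element, the monomial `1`. -/
def lcmLattice' : Set (X →₀ ℕ) := lcmLattice I \ {0}

/-- The `n`-faces of the order complex `Δ` of `lcmLattice' I` which belong to `Δ_{≤ a}` but not to
`Δ_{< a}`: the chains `a₀ < ⋯ < aₙ` with `aₙ = a`. -/
@[ext]
structure Face (a : X →₀ ℕ) (n : ℕ) : Type u where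
  /-- the vertices, in increasing order -/
  vertex : Fin (n + 1) → (X →₀ ℕ)
  strictMono : StrictMono vertex
  mem : ∀ i, vertex i ∈ lcmLattice' I
  last_eq : vertex (Fin.last n) = a

variable {I} in
/-- The face obtained by omitting a vertex other than the largest one. -/
def Face.remove {a : X →₀ ℕ} {n : ℕ} (c : Face I a (n + 1)) (i : Fin (n + 1)) : Face I a n where
  vertex j := c.vertex (i.castSucc.succAbove j)
  strictMono := c.strictMono.comp (Fin.strictMono_succAbove _)
  mem _ := c.mem _
  last_eq := by
    rw [Fin.succAbove_castSucc_of_le _ _ (Fin.le_last i), Fin.succ_last]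
    exact c.last_eq

variable (F : Type v) [Field F]

/-- The relative chains `C_n(Δ_{≤ a}, Δ_{< a}; F)`, with their canonical basis. -/
abbrev RelChain (a : X →₀ ℕ) (n : ℕ) : Type (max u v) := Face I a n →₀ F

/-- The differential `d_n` of the relative chain complex.  Omitting the largest vertex gives a
face of `Δ_{< a}`, hence zero.  The differential `d_0` is zero (its target plays no role). -/
def relBd (a : X →₀ ℕ) : ∀ n, RelChain I F a n →ₗ[F] RelChain I F a (n - 1)
  | 0 => 0
  | n + 1 => Finsupp.lsum F fun c : Face I a (n + 1) =>
      LinearMap.toSpanSingleton F (RelChain I F a n)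
        (∑ i : Fin (n + 1), Finsupp.single (c.remove i) ((-1 : F) ^ (i : ℕ)))

/-! ### Matroidal splittings -/

variable {I F}

/-- `Xn` is a set of elements of the canonical basis which `d_n` maps bijectively onto a basis of
`im d_n`. -/
def IsImageBasis {a : X →₀ ℕ} {n : ℕ} (Xn : Set (Face I a n)) : Prop :=
  LinearIndepOn F (fun b => relBd I F a n (Finsupp.single b 1)) Xn ∧
    Submodule.span F ((fun b => relBd I F a n (Finsupp.single b 1)) '' Xn) =
      LinearMap.range (relBd I F a n)

/-- The set `K_n` of the cycles `z(b) = b - ∑_{c ∈ Xn} r_c c`, for `b ∉ Xn`, where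
`d_n(b) = ∑_{c ∈ Xn} r_c d_n(c)`. -/
def fundCycles (F : Type v) [Field F] {a : X →₀ ℕ} {n : ℕ} (Xn : Set (Face I a n)) :
    Set (RelChain I F a n) :=
  {z | relBd I F a n z = 0 ∧ ∃ b ∉ Xn,
    Finsupp.single b 1 - z ∈ Submodule.span F ((fun c => Finsupp.single c (1 : F)) '' Xn)}

/-- `Zn` is mapped bijectively onto a basis of the homology `H_n = ker d_n / im d_{n+1}`, seen
inside `C_n / im d_{n+1}`. -/
def IsHomologyBasis {a : X →₀ ℕ} {n : ℕ} (Zn : Set (RelChain I F a n)) : Prop :=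
  LinearIndepOn F (LinearMap.range (relBd I F a (n + 1))).mkQ Zn ∧
    Submodule.span F ((LinearMap.range (relBd I F a (n + 1))).mkQ '' Zn) =
      (LinearMap.ker (relBd I F a n)).map (LinearMap.range (relBd I F a (n + 1))).mkQ

/-- The set `MSpl(a)` of matroidal splittings of `C_•(Δ_{≤ a}, Δ_{< a}; F)`.  Choices of bases
`X_n` and `Z_n` make `X_n ∪ Z_n ∪ d_{n+1}(X_{n+1})` a basis of `C_n` for all `n`, and the induced
splitting is the homotopy `D` which is inverse to `d_{n+1}` on `d_{n+1}(X_{n+1})` and vanishes on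
`X_n` and on `Z_n`.  Splittings induced by different choices count once if they are equal. -/
def matroidalSplittings (I : AddSemigroupIdeal (X →₀ ℕ)) (F : Type v) [Field F] (a : X →₀ ℕ) :
    Set (∀ n, RelChain I F a n →ₗ[F] RelChain I F a (n + 1)) :=
  {D | ∃ (Xs : ∀ n, Set (Face I a n)) (Zs : ∀ n, Set (RelChain I F a n)),
    (∀ n, IsImageBasis (F := F) (Xs n)) ∧
    (∀ n, Zs n ⊆ fundCycles F (Xs n)) ∧
    (∀ n, IsHomologyBasis (Zs n)) ∧
    (∀ n, ∀ b ∈ Xs (n + 1),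
      D n (relBd I F a (n + 1) (Finsupp.single b 1)) = Finsupp.single b 1) ∧
    (∀ n, ∀ b ∈ Xs n, D n (Finsupp.single b 1) = 0) ∧
    (∀ n, ∀ z ∈ Zs n, D n z = 0)}

variable (k : Type v) [Field k]

/-- The number `m(a)` of matroidal splittings over the prime field of `k`. -/
def matroidalCount (I : AddSemigroupIdeal (X →₀ ℕ)) (a : X →₀ ℕ) : ℕ :=
  (matroidalSplittings I (⊥ : Subfield k) a).ncard

/-- `a` is critical over `k` if the characteristic of `k` divides `m(a)`. -/
def IsCritical (I : AddSemigroupIdeal (X →₀ ℕ)) (a : X →₀ ℕ) : Prop :=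
  ringChar k ∣ matroidalCount k I a

end Lattice

end

end MonomialRes

/-! The two assertions are independent, and each holds once `p` exceeds a bound that depends only on
`I`.

Resolution: an automorphism of `M(X)` permutes the variables, so `G_I` is finite and preserves
degrees. If `p > |G_I|`, Maschke's theorem is available and the usual construction of a graded
minimal resolution can be made equivariant, with trivial action on the field. Given a homogeneous
stable submodule `K`, choose in each degree a stable complement of `(𝔪K)_d` in `K_d`. The free
module on these complements maps onto `K` by graded Nakayama, and its kernel lies in `𝔪` times the
free module (`GradedRep.IsStable.exists_cover`). The kernel is again homogeneous, stable and
finitely generated, so the step iterates, starting from `I k[X]`.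

Counting: `C_n` is spanned by `X_n`, `Z_n` and `d(X_{n+1})`, so a splitting is determined by the
`X_n` and by the faces `b` with `z(b) ∈ Z_n`. These are two sets of faces, so `m(a)` has a bound
that does not involve the field (`finite_matroidalSplittings`). Splittings always exist
(`matroidalSplittings_nonempty`), so for large `p` one has `0 < m(a) < p`, and `p` cannot divide
`m(a)`. -/

namespace MonomialRes

noncomputable section

/-! ### Homogeneous components of polynomials -/

section HomComp

variable {X : Type u} {k : Type v} [Field k]

/-- The component of degree `e ∈ ℤ` of a polynomial. -/
def homComp (e : ℤ) : MvPolynomial X k →ₗ[k] MvPolynomial X k :=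
  if 0 ≤ e then MvPolynomial.homogeneousComponent e.toNat else 0

theorem coeff_homComp (e : ℤ) (r : MvPolynomial X k) (f : X →₀ ℕ) :
    MvPolynomial.coeff f (homComp e r) =
      if (f.degree : ℤ) = e then MvPolynomial.coeff f r else 0 := by
  unfold homComp
  split_ifs with h1 h2 h2
  · rw [MvPolynomial.coeff_homogeneousComponent, if_pos (by omega)]
  · rw [MvPolynomial.coeff_homogeneousComponent, if_neg (by omega)]
  · omega
  · simp

theorem homComp_monomial (e : ℤ) (f : X →₀ ℕ) (c : k) :
    homComp e (MvPolynomial.monomial f c) =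
      if (f.degree : ℤ) = e then MvPolynomial.monomial f c else 0 := by
  classical
  ext g
  rw [coeff_homComp]
  split_ifs with h1 h2 h2
  · rfl
  · rw [MvPolynomial.coeff_monomial, if_neg (by rintro rfl; exact h2 h1)]; simp
  · rw [MvPolynomial.coeff_monomial, if_neg (by rintro rfl; exact h1 h2)]
  · simp

theorem homComp_homComp (d e : ℤ) (r : MvPolynomial X k) :
    homComp d (homComp e r) = if d = e then homComp e r else 0 := by
  ext f
  split_ifs with h <;> simp only [coeff_homComp, MvPolynomial.coeff_zero]
  · subst h; split_ifs <;> rfl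
  · split_ifs with h1 h2
    · omega
    · rfl
    · rfl

theorem homComp_of_neg {e : ℤ} (he : e < 0) (r : MvPolynomial X k) : homComp e r = 0 := by
  simp [homComp, not_le.2 he]

theorem homComp_C (e : ℤ) (c : k) :
    homComp e (MvPolynomial.C c : MvPolynomial X k) =
      if e = 0 then MvPolynomial.C c else 0 := by
  have := homComp_monomial e (0 : X →₀ ℕ) c
  simpa [eq_comm] using this

theorem homComp_mul_X (e : ℤ) (r : MvPolynomial X k) (i : X) :
    homComp e (r * MvPolynomial.X i) = homComp (e - 1) r * MvPolynomial.X i := by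
  classical
  induction r using MvPolynomial.induction_on' with
  | monomial f c =>
    rw [MvPolynomial.X, MvPolynomial.monomial_mul, mul_one, homComp_monomial, homComp_monomial]
    simp only [map_add, Finsupp.degree_single]
    split_ifs with h1 h2 h2
    · rw [MvPolynomial.monomial_mul, mul_one]
    · push_cast at h1; omega
    · push_cast at h1; omega
    · simp
  | add p q hp hq => simp only [add_mul, map_add, hp, hq]

/-- Allowing every larger `t` lets the index sets of several polynomials be merged by a union. -/
theorem exists_sum_homComp (r : MvPolynomial X k) (d : ℤ) :
    ∃ s : Finset ℤ, ∀ t, s ⊆ t → ∑ e ∈ t, homComp (e - d) r = r := by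
  refine ⟨(Finset.range (r.totalDegree + 1)).image fun n : ℕ => (n : ℤ) + d, fun t ht => ?_⟩
  ext f
  rw [MvPolynomial.coeff_sum]
  simp only [coeff_homComp, eq_sub_iff_add_eq, Finset.sum_ite_eq]
  split_ifs with h
  · rfl
  · by_contra hc
    have := MvPolynomial.le_totalDegree (MvPolynomial.mem_support_iff.2 (Ne.symm hc))
    change f.degree ≤ _ at this
    exact h (ht (Finset.mem_image.2 ⟨f.degree, Finset.mem_range.2 (by omega), rfl⟩))

theorem isZHomogeneous_iff (q : MvPolynomial X k) (e : ℤ) :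
    IsZHomogeneous q e ↔ homComp e q = q := by
  constructor
  · intro h
    ext f
    rw [coeff_homComp]
    split_ifs with h1
    · rfl
    · by_contra hc
      exact h1 (h f (Ne.symm hc))
  · intro h f hf
    rw [← h, coeff_homComp] at hf
    by_contra hc
    rw [if_neg hc] at hf
    exact hf rfl

theorem X_mem_irrelevantIdeal (i : X) :
    (MvPolynomial.X i : MvPolynomial X k) ∈ irrelevantIdeal k X :=
  Ideal.subset_span ⟨i, rfl⟩

theorem sub_C_mem_irrelevantIdeal (r : MvPolynomial X k) :
    r - MvPolynomial.C (MvPolynomial.constantCoeff r) ∈ irrelevantIdeal k X := by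
  induction r using MvPolynomial.induction_on with
  | C c => simp
  | add p q hp hq =>
    rw [map_add, map_add, add_sub_add_comm]
    exact add_mem hp hq
  | mul_X p i hp =>
    simp only [map_mul, MvPolynomial.constantCoeff_X, mul_zero, map_zero, sub_zero]
    exact Ideal.mul_mem_left _ _ (X_mem_irrelevantIdeal i)

/-- An induction principle for `𝔪 K`. -/
theorem irrelevantIdeal_smul_induction {M : Type*} [AddCommGroup M] [Module (MvPolynomial X k) M]
    {K : Submodule (MvPolynomial X k) M} {P : M → Prop} (zero : P 0)
    (add : ∀ x y, P x → P y → P (x + y))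
    (smul : ∀ i, ∀ y ∈ K, P ((MvPolynomial.X i : MvPolynomial X k) • y)) {x : M}
    (hx : x ∈ irrelevantIdeal k X • K) : P x := by
  refine Submodule.smul_induction_on hx (fun r hr => ?_) (fun x y => add x y)
  refine Submodule.span_induction ?_ ?_ ?_ ?_ hr
  · rintro _ ⟨i, rfl⟩ y hy
    exact smul i y hy
  · intro y _
    rw [zero_smul]
    exact zero
  · intro a b _ _ ha hb y hy
    rw [add_smul]
    exact add _ _ (ha y hy) (hb y hy)
  · intro s a _ ha y hy
    rw [smul_eq_mul, mul_comm, mul_smul]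
    exact ha _ (K.smul_mem s hy)

end HomComp

/-! ### Graded modules with a semilinear group action -/

section GradedRep

variable {X : Type u} {k : Type v} [Field k] {G : Type w} [Group G]

/-- A `ℕ`-grading of a `k[X]`-module, given by the projections to its components, with a degree
preserving action of `G` which is semilinear along an action `a` of `G` on `k[X]`. -/
structure GradedRep (a : G →* (MvPolynomial X k →ₐ[k] MvPolynomial X k)) (M : Type*)
    [AddCommGroup M] [Module (MvPolynomial X k) M] [Module k M]
    [IsScalarTower k (MvPolynomial X k) M] where
  /-- the projection to the component of degree `d` -/
  proj : ℤ → M →ₗ[k] M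
  proj_proj : ∀ d x, proj d (proj d x) = proj d x
  proj_ne : ∀ d e x, d ≠ e → proj d (proj e x) = 0
  proj_neg : ∀ d x, d < 0 → proj d x = 0
  exists_sum : ∀ x, ∃ s : Finset ℤ, ∑ d ∈ s, proj d x = x
  proj_X_smul : ∀ d i x, proj d ((MvPolynomial.X i : MvPolynomial X k) • x) =
    (MvPolynomial.X i : MvPolynomial X k) • proj (d - 1) x
  /-- the action of `G` -/
  act : Representation k G M
  act_smul : ∀ σ (r : MvPolynomial X k) x, act σ (r • x) = a σ r • act σ x
  act_proj : ∀ σ d x, act σ (proj d x) = proj d (act σ x)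

namespace GradedRep

variable {a : G →* (MvPolynomial X k →ₐ[k] MvPolynomial X k)} {M : Type*}
    [AddCommGroup M] [Module (MvPolynomial X k) M] [Module k M]
    [IsScalarTower k (MvPolynomial X k) M] (S : GradedRep a M)

theorem proj_of_eq {d e : ℤ} {x : M} (h : S.proj e x = x) (hne : d ≠ e) : S.proj d x = 0 := by
  rw [← h, S.proj_ne d e x hne]

/-- The grading axiom only treats multiplication by a variable; induction on `r` extends it to all
polynomials. -/
theorem proj_smul {d : ℤ} {y : M} (hy : S.proj d y = y) (e : ℤ) (r : MvPolynomial X k) :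
    S.proj e (r • y) = homComp (e - d) r • y := by
  induction r using MvPolynomial.induction_on generalizing e with
  | C c =>
    rw [homComp_C, MvPolynomial.C_eq_smul_one, smul_assoc, one_smul, map_smul]
    split_ifs with h
    · obtain rfl : e = d := by omega
      rw [hy, smul_assoc, one_smul]
    · rw [S.proj_of_eq hy (by omega), smul_zero, zero_smul]
  | add p q hp hq => rw [add_smul, map_add, map_add, hp, hq, add_smul]
  | mul_X p i hp =>
    rw [mul_comm, mul_smul, S.proj_X_smul, hp, smul_smul, mul_comm _ p, homComp_mul_X, mul_comm,
      show e - d - 1 = e - 1 - d by ring]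

/-- A homogeneous submodule which is stable under the action. -/
structure IsStable (K : Submodule (MvPolynomial X k) M) : Prop where
  proj_mem : ∀ d, ∀ x ∈ K, S.proj d x ∈ K
  act_mem : ∀ σ, ∀ x ∈ K, S.act σ x ∈ K

variable {S} {K : Submodule (MvPolynomial X k) M}

theorem IsStable.irrelevantIdeal_smul (hK : S.IsStable K)
    (ha : ∀ σ i, a σ (MvPolynomial.X i) ∈ irrelevantIdeal k X) :
    S.IsStable (irrelevantIdeal k X • K) where
  proj_mem d x hx := by
    refine irrelevantIdeal_smul_induction
      (P := fun x => S.proj d x ∈ irrelevantIdeal k X • K) (by simp) ?_ ?_ hx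
    · intro x y hx hy
      rw [map_add]
      exact add_mem hx hy
    · intro i y hy
      rw [S.proj_X_smul]
      exact Submodule.smul_mem_smul (X_mem_irrelevantIdeal i) (hK.proj_mem _ _ hy)
  act_mem σ x hx := by
    refine irrelevantIdeal_smul_induction
      (P := fun x => S.act σ x ∈ irrelevantIdeal k X • K) (by simp) ?_ ?_ hx
    · intro x y hx hy
      rw [map_add]
      exact add_mem hx hy
    · intro i y hy
      rw [S.act_smul]
      exact Submodule.smul_mem_smul (ha σ i) (hK.act_mem _ _ hy)

variable (S K) in
/-- The component of degree `d` of a homogeneous submodule. -/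
def comp (d : ℤ) : Submodule k M := K.restrictScalars k ⊓ LinearMap.eqLocus (S.proj d) .id

theorem IsStable.act_mem_comp (hK : S.IsStable K) (d : ℤ) (σ : G) {x : M} (hx : x ∈ S.comp K d) :
    S.act σ x ∈ S.comp K d :=
  ⟨hK.act_mem σ x hx.1, by
    have : S.proj d x = x := hx.2
    change S.proj d (S.act σ x) = S.act σ x
    rw [← S.act_proj, this]⟩

/-- The graded version of Nakayama's lemma. -/
theorem IsStable.le_of_comp_le (hK : S.IsStable K) {V : ℤ → Submodule k M}
    (hV : ∀ d, S.comp K d ≤ V d ⊔ (irrelevantIdeal k X • K).restrictScalars k)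
    (hV' : ∀ d, V d ≤ S.comp K d)
    {N : Submodule (MvPolynomial X k) M} (hN : ∀ d, V d ≤ N.restrictScalars k) : K ≤ N := by
  -- Induction on the degree, which starts because components of negative degree vanish.
  -- Multiplication by a variable raises degrees by one, so the `𝔪K` part in degree `d` comes from
  -- degree `d - 1`.
  have key : ∀ n : ℕ, ∀ d : ℤ, d < n → ∀ x ∈ K, S.proj d x ∈ N := by
    intro n
    induction n with
    | zero =>
      intro d hd x _
      rw [S.proj_neg d x (by simpa using hd)]
      exact zero_mem _
    | succ n ih =>
      intro d hd x hx
      have h1 : S.proj d x ∈ S.comp K d := ⟨hK.proj_mem d x hx, S.proj_proj d x⟩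
      obtain ⟨v, hv, y, hy, hvy⟩ := Submodule.mem_sup.1 (hV d h1)
      have h2 : S.proj d x = v + S.proj d y := by
        rw [← S.proj_proj, ← hvy, map_add, (hV' d hv).2]
        rfl
      rw [h2]
      refine add_mem (hN d hv) ?_
      refine irrelevantIdeal_smul_induction (P := fun y => S.proj d y ∈ N) (by simp) ?_ ?_
        (show y ∈ irrelevantIdeal k X • K from hy)
      · intro x y hx hy
        rw [map_add]
        exact add_mem hx hy
      · intro i y hy
        rw [S.proj_X_smul]
        exact N.smul_mem _ (ih _ (by push_cast at hd; omega) y hy)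
  intro x hx
  obtain ⟨s, hs⟩ := S.exists_sum x
  rw [← hs]
  -- `d.toNat + 1` exceeds `d` also when `d` is negative.
  exact sum_mem fun d _ => key (d.toNat + 1) d (by push_cast; omega) x hx

/-- Maschke's theorem for a pair of stable subspaces. -/
theorem _root_.Representation.exists_stable_compl [Finite G] [NeZero (Nat.card G : k)] {E : Type*}
    [AddCommGroup E] [Module k E] (ρ : Representation k G E) {A B : Submodule k E} (hAB : A ≤ B)
    (hA : ∀ σ, ∀ x ∈ A, ρ σ x ∈ A) (hB : ∀ σ, ∀ x ∈ B, ρ σ x ∈ B) :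
    ∃ V ≤ B, B ≤ V ⊔ A ∧ Disjoint V A ∧ ∀ σ, ∀ x ∈ V, ρ σ x ∈ V := by
  have : ρ.IsSemisimpleRepresentation := inferInstance
  have : ComplementedLattice (Subrepresentation ρ) := this
  let A' : Subrepresentation ρ := ⟨A, fun σ x hx => hA σ x hx⟩
  let B' : Subrepresentation ρ := ⟨B, fun σ x hx => hB σ x hx⟩
  obtain ⟨C, hC⟩ := exists_isCompl A'
  -- Modular law: as `A ≤ B`, a complement of `A` in `E` cuts out a complement of `A` in `B`.
  refine ⟨C.toSubmodule ⊓ B, inf_le_right, ?_, ?_, ?_⟩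
  · have h1 : A ⊔ C.toSubmodule = ⊤ := congrArg Subrepresentation.toSubmodule hC.sup_eq_top
    intro x hx
    obtain ⟨y, hy, z, hz, rfl⟩ :=
      Submodule.mem_sup.1 (h1 ▸ Submodule.mem_top : x ∈ A ⊔ C.toSubmodule)
    rw [add_comm]
    refine Submodule.add_mem_sup ⟨hz, ?_⟩ hy
    have := B.sub_mem hx (hAB hy)
    rwa [add_sub_cancel_left] at this
  · have h1 : A ⊓ C.toSubmodule = ⊥ := congrArg Subrepresentation.toSubmodule hC.inf_eq_bot
    rw [disjoint_iff, eq_bot_iff, ← h1]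
    exact fun x hx => ⟨hx.2, hx.1.1⟩
  · exact fun σ x hx => ⟨C.apply_mem_toSubmodule σ hx.1, hB σ x hx.2⟩

/-- A homogeneous stable submodule `K` has homogeneous stable subspaces of generators, which are
complementary to `𝔪 K`. -/
theorem IsStable.exists_generators [Finite G] [NeZero (Nat.card G : k)] (hK : S.IsStable K)
    (ha : ∀ σ i, a σ (MvPolynomial.X i) ∈ irrelevantIdeal k X) :
    ∃ V : ℤ → Submodule k M, (∀ d, V d ≤ S.comp K d) ∧
      (∀ d, S.comp K d ≤ V d ⊔ (irrelevantIdeal k X • K).restrictScalars k) ∧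
      (∀ d, Disjoint (V d) ((irrelevantIdeal k X • K).restrictScalars k)) ∧
      ∀ d σ, ∀ x ∈ V d, S.act σ x ∈ V d := by
  have hmK := hK.irrelevantIdeal_smul ha
  have hle : ∀ d, S.comp (irrelevantIdeal k X • K) d ≤ S.comp K d := fun d x hx =>
    ⟨(Submodule.smul_le_right : irrelevantIdeal k X • K ≤ K) hx.1, hx.2⟩
  have h := fun d => Representation.exists_stable_compl S.act (hle d)
    (fun σ x hx => hmK.act_mem_comp d σ hx) (fun σ x hx => hK.act_mem_comp d σ hx)
  choose V h1 h2 h3 h4 using h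
  -- Elements of `V d` have degree `d`, so being disjoint from the degree `d` part of `𝔪K` is being
  -- disjoint from all of `𝔪K`.
  refine ⟨V, h1, fun d => (h2 d).trans (sup_le_sup_left inf_le_left _), fun d => ?_, h4⟩
  rw [Submodule.disjoint_def]
  exact fun x hx hx' => Submodule.disjoint_def.1 (h3 d) x hx ⟨hx', (h1 d hx).2⟩

end GradedRep

end GradedRep

/-! ### Free modules generated by graded representations -/

section TwistedRep

variable {X : Type u} {k : Type v} [Field k] {G : Type w} [Group G]

/-- The projection of `⨁_d k[X](-d)^{β_d}` to its component of degree `e`. -/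
def twistedProj (β : ℤ → ℕ) (e : ℤ) : TwistedFree X k β →ₗ[k] TwistedFree X k β :=
  Finsupp.lsum k fun i => Finsupp.lsingle i ∘ₗ homComp (e - i.1)

variable {β : ℤ → ℕ}

theorem twistedProj_single (e : ℤ) (i : (d : ℤ) × Fin (β d)) (r : MvPolynomial X k) :
    twistedProj β e (Finsupp.single i r) = Finsupp.single i (homComp (e - i.1) r) := by
  simp [twistedProj]

theorem twistedProj_apply (e : ℤ) (h : TwistedFree X k β) (i : (d : ℤ) × Fin (β d)) :
    twistedProj β e h i = homComp (e - i.1) (h i) := by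
  classical
  induction h using Finsupp.induction_linear with
  | zero => simp
  | add f g hf hg => simp only [map_add, Finsupp.add_apply, hf, hg]
  | single j r =>
    rw [twistedProj_single, Finsupp.single_apply, Finsupp.single_apply]
    split_ifs with h
    · rw [h]
    · simp

theorem exists_sum_twistedProj (x : TwistedFree X k β) :
    ∃ s : Finset ℤ, ∀ t, s ⊆ t → ∑ d ∈ t, twistedProj β d x = x := by
  induction x using Finsupp.induction_linear with
  | zero => exact ⟨∅, by simp⟩
  | add x y hx hy =>
    obtain ⟨s, hs⟩ := hx
    obtain ⟨s', hs'⟩ := hy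
    refine ⟨s ∪ s', fun t ht => ?_⟩
    simp only [map_add, Finset.sum_add_distrib]
    rw [hs t (Finset.union_subset_left ht), hs' t (Finset.union_subset_right ht)]
  | single i r =>
    obtain ⟨s, hs⟩ := exists_sum_homComp r i.1
    refine ⟨s, fun t ht => ?_⟩
    simp only [twistedProj_single]
    rw [← Finsupp.single_finsetSum, hs t ht]

theorem isHomogeneous_iff_twistedProj (h : TwistedFree X k β) (e : ℤ) :
    h.IsHomogeneous e ↔ twistedProj β e h = h := by
  rw [Finsupp.ext_iff]
  exact forall_congr' fun i => by rw [twistedProj_apply, isZHomogeneous_iff]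

variable {V : ℤ → Type*} [∀ d, AddCommGroup (V d)] [∀ d, Module k (V d)]

theorem basis_induction {ι E : Type*} [AddCommGroup E] [Module k E] (b : Module.Basis ι k E)
    {P : E → Prop} (zero : P 0) (add : ∀ v w, P v → P w → P (v + w))
    (smul : ∀ (c : k) v, P v → P (c • v)) (basis : ∀ i, P (b i)) (v : E) : P v :=
  Submodule.span_induction (p := fun v _ => P v) (by rintro _ ⟨i, rfl⟩; exact basis i) zero
    (fun v w _ _ => add v w) (fun c v _ => smul c v) (b.mem_span v)

/-- The embedding of `V d` which sends a basis to the canonical basis in degree `d`. -/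
def twistedIncl (b : ∀ d, Module.Basis (Fin (β d)) k (V d)) (d : ℤ) :
    V d →ₗ[k] TwistedFree X k β :=
  (b d).constr k fun j => Finsupp.single ⟨d, j⟩ 1

variable (b : ∀ d, Module.Basis (Fin (β d)) k (V d))

theorem twistedIncl_basis (d : ℤ) (j : Fin (β d)) :
    (twistedIncl b d (b d j) : TwistedFree X k β) = Finsupp.single ⟨d, j⟩ 1 := by
  simp [twistedIncl]

theorem twistedProj_smul_twistedIncl (e d : ℤ) (r : MvPolynomial X k) (v : V d) :
    twistedProj β e (r • (twistedIncl b d v : TwistedFree X k β)) =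
      homComp (e - d) r • twistedIncl b d v := by
  induction v using basis_induction (b d) with
  | zero => simp
  | add v w hv hw => simp only [map_add, smul_add, hv, hw]
  | smul c v hv =>
    rw [map_smul (twistedIncl b d), smul_comm r c, smul_comm (homComp (e - d) r) c, map_smul, hv]
  | basis j =>
    rw [twistedIncl_basis, Finsupp.smul_single, smul_eq_mul, mul_one, twistedProj_single,
      Finsupp.smul_single, smul_eq_mul, mul_one]

variable (a : G →* (MvPolynomial X k →ₐ[k] MvPolynomial X k))
  (ρ : ∀ d, Representation k G (V d))

/-- The semilinear extension of a graded representation to a free module. -/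
def twistedActLin (σ : G) : TwistedFree X k β →ₗ[k] TwistedFree X k β :=
  Finsupp.lsum k fun i =>
    (LinearMap.toSpanSingleton (MvPolynomial X k) (TwistedFree X k β)
      (twistedIncl b i.1 (ρ i.1 σ (b i.1 i.2)))).restrictScalars k ∘ₗ (a σ).toLinearMap

theorem twistedActLin_single (σ : G) (i : (d : ℤ) × Fin (β d)) (r : MvPolynomial X k) :
    twistedActLin b a ρ σ (Finsupp.single i r) =
      a σ r • twistedIncl b i.1 (ρ i.1 σ (b i.1 i.2)) := by
  simp [twistedActLin]

theorem twistedActLin_smul (σ : G) (r : MvPolynomial X k) (h : TwistedFree X k β) :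
    twistedActLin b a ρ σ (r • h) = a σ r • twistedActLin b a ρ σ h := by
  induction h using Finsupp.induction_linear with
  | zero => simp
  | add f g hf hg => simp only [map_add, smul_add, hf, hg]
  | single i s =>
    rw [Finsupp.smul_single, twistedActLin_single, twistedActLin_single, smul_eq_mul, map_mul,
      mul_smul]

/-- The extension is defined through a basis but restricts to `ρ` on all of `V d`; this makes it
multiplicative in `σ`. -/
theorem twistedActLin_twistedIncl (σ : G) (d : ℤ) (v : V d) :
    twistedActLin b a ρ σ (twistedIncl b d v) = twistedIncl b d (ρ d σ v) := by
  induction v using basis_induction (b d) with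
  | zero => simp
  | add v w hv hw => simp only [map_add, hv, hw]
  | smul c v hv => simp only [map_smul, hv]
  | basis j => rw [twistedIncl_basis, twistedActLin_single, map_one, one_smul]

/-- The semilinear extension of a graded representation to a free module, as a representation. -/
def twistedAct : Representation k G (TwistedFree X k β) where
  toFun := twistedActLin b a ρ
  map_one' := by
    refine Finsupp.lhom_ext fun i r => ?_
    rw [twistedActLin_single, map_one, map_one, Module.End.one_apply, Module.End.one_apply,
      twistedIncl_basis, AlgHom.one_apply, Finsupp.smul_single, smul_eq_mul, mul_one]
  map_mul' σ τ := by
    refine Finsupp.lhom_ext fun i r => ?_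
    rw [Module.End.mul_apply, twistedActLin_single, twistedActLin_single, twistedActLin_smul,
      twistedActLin_twistedIncl, map_mul, map_mul]
    rfl

/-- The free module generated by a graded representation. -/
def twistedRep (ha : ∀ σ e r, a σ (homComp e r) = homComp e (a σ r))
    (hβ : ∀ d < 0, β d = 0) [Finite ((d : ℤ) × Fin (β d))] :
    GradedRep a (TwistedFree X k β) where
  proj := twistedProj β
  proj_proj d x := by
    ext1 i
    rw [twistedProj_apply, twistedProj_apply, homComp_homComp, if_pos rfl]
  proj_ne d e x h := by
    ext1 i
    rw [twistedProj_apply, twistedProj_apply, homComp_homComp, if_neg (by omega)]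
    rfl
  proj_neg d x hd := by
    ext1 i
    rw [twistedProj_apply, homComp_of_neg]
    · rfl
    -- A summand generated in negative degree would have an index in the empty type `Fin 0`.
    · by_contra hc
      have h1 := hβ i.1 (by omega)
      have h2 := i.2.2
      omega
  exists_sum x := (exists_sum_twistedProj x).imp fun s hs => hs s subset_rfl
  proj_X_smul d i x := by
    ext1 j
    rw [twistedProj_apply, Finsupp.smul_apply, Finsupp.smul_apply, twistedProj_apply, smul_eq_mul,
      smul_eq_mul, mul_comm, homComp_mul_X, mul_comm, show d - j.1 - 1 = d - 1 - j.1 by ring]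
  act := twistedAct b a ρ
  act_smul := twistedActLin_smul b a ρ
  act_proj σ d x := by
    change twistedActLin b a ρ σ _ = twistedProj β d (twistedActLin b a ρ σ _)
    induction x using Finsupp.induction_linear with
    | zero => simp
    | add f g hf hg => simp only [map_add, hf, hg]
    | single i r =>
      rw [twistedActLin_single, twistedProj_single, twistedActLin_single,
        twistedProj_smul_twistedIncl, ha]

end TwistedRep

/-! ### Equivariant projective covers -/

section Cover

variable {X : Type u} {k : Type v} [Field k] {G : Type w} [Group G]
  {a : G →* (MvPolynomial X k →ₐ[k] MvPolynomial X k)} {M : Type*}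
    [AddCommGroup M] [Module (MvPolynomial X k) M] [Module k M]
    [IsScalarTower k (MvPolynomial X k) M] {S : GradedRep a M}
    {K : Submodule (MvPolynomial X k) M}

/-- Module generators span `K` over `k` modulo `𝔪K`, because `r` and its constant term differ by an
element of `𝔪`. -/
theorem exists_finite_span_sup_irrelevantIdeal_smul (hK : K.FG) :
    ∃ T : Set M, T.Finite ∧ K.restrictScalars k ≤
      Submodule.span k T ⊔ (irrelevantIdeal k X • K).restrictScalars k := by
  obtain ⟨T, hT⟩ := hK
  refine ⟨T, T.finite_toSet, fun x hx => ?_⟩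
  rw [Submodule.restrictScalars_mem, ← hT] at hx
  refine Submodule.span_induction (fun x hx => ?_) (zero_mem _) (fun x y _ _ hx hy => add_mem hx hy)
    (fun r x hx' hx => ?_) hx
  · exact Submodule.mem_sup_left (Submodule.subset_span hx)
  · rw [hT] at hx'
    have h1 : r • x = MvPolynomial.constantCoeff r • x +
        (r - MvPolynomial.C (MvPolynomial.constantCoeff r)) • x := by
      rw [sub_smul, MvPolynomial.C_eq_smul_one, smul_assoc, one_smul, add_sub_cancel]
    rw [h1]
    exact add_mem (Submodule.smul_mem _ _ hx)
      (Submodule.mem_sup_right (show _ ∈ irrelevantIdeal k X • K from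
        Submodule.smul_mem_smul (sub_C_mem_irrelevantIdeal r) hx'))

variable {V : ℤ → Submodule k M} (hV : ∀ d, V d ≤ S.comp K d)
include hV

theorem GradedRep.proj_linearCombination {ι : ℤ → Type*}
    (b : ∀ d, Module.Basis (ι d) k (V d)) (l : ((d : ℤ) × ι d) →₀ k) (d : ℤ) :
    S.proj d (Finsupp.linearCombination k (fun i : (d : ℤ) × ι d => (b i.1 i.2 : M)) l) =
      (Finsupp.linearCombination k (b d) (l.split d) : V d) := by
  classical
  induction l using Finsupp.induction_linear with
  | zero =>
    have : Finsupp.split (0 : ((d : ℤ) × ι d) →₀ k) d = 0 := by ext j; simp [Finsupp.split_apply]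
    simp [this]
  | add f g hf hg =>
    have : Finsupp.split (f + g) d = f.split d + g.split d := by
      ext j; simp [Finsupp.split_apply]
    rw [map_add, map_add, hf, hg, this, map_add]
    rfl
  | single i c =>
    obtain ⟨e, j⟩ := i
    rw [Finsupp.linearCombination_single, map_smul]
    by_cases h : d = e
    · subst h
      have : Finsupp.split (Finsupp.single (⟨d, j⟩ : (d : ℤ) × ι d) c) d = Finsupp.single j c := by
        ext j'
        simp [Finsupp.split_apply, Finsupp.single_apply]
      rw [this, Finsupp.linearCombination_single, (hV d (b d j).2).2]
      rfl
    · have : Finsupp.split (Finsupp.single (⟨e, j⟩ : (d : ℤ) × ι d) c) d = 0 := by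
        ext j'
        rw [Finsupp.split_apply, Finsupp.single_eq_of_ne]
        · rfl
        · rintro h'
          exact h (congrArg Sigma.fst h')
      rw [this, S.proj_of_eq (hV e (b e j).2).2 h, smul_zero, map_zero]
      rfl

variable (hV' : ∀ d, Disjoint (V d) ((irrelevantIdeal k X • K).restrictScalars k))
include hV'

/-- Bases of the `V d` stay jointly independent modulo `𝔪K`: since `𝔪K` is homogeneous, each graded
part of the combination lies in `V d ∩ 𝔪K = 0`. -/
theorem GradedRep.IsStable.eq_zero_of_linearCombination_mem (hK : S.IsStable K)
    (ha : ∀ σ i, a σ (MvPolynomial.X i) ∈ irrelevantIdeal k X) {ι : ℤ → Type*}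
    (b : ∀ d, Module.Basis (ι d) k (V d)) (l : ((d : ℤ) × ι d) →₀ k)
    (hl : Finsupp.linearCombination k (fun i : (d : ℤ) × ι d => (b i.1 i.2 : M)) l ∈
      irrelevantIdeal k X • K) : l = 0 := by
  ext ⟨d, j⟩
  have h1 := (hK.irrelevantIdeal_smul ha).proj_mem d _ hl
  rw [GradedRep.proj_linearCombination hV] at h1
  have h2 := Submodule.disjoint_def.1 (hV' d) _ (Submodule.coe_mem _) h1
  rw [ZeroMemClass.coe_eq_zero] at h2
  have h3 := linearIndependent_iff.1 (b d).linearIndependent _ h2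
  have h4 := DFunLike.congr_fun h3 j
  rwa [Finsupp.split_apply] at h4

/-- All the `V d` together embed in a finite-dimensional subspace of `M/𝔪K`, so the total number of
generators is finite. -/
theorem GradedRep.IsStable.exists_basis (hK : S.IsStable K) (hfg : K.FG)
    (ha : ∀ σ i, a σ (MvPolynomial.X i) ∈ irrelevantIdeal k X) :
    ∃ β : ℤ → ℕ, Finite ((d : ℤ) × Fin (β d)) ∧ (∀ d < 0, β d = 0) ∧
      Nonempty (∀ d, Module.Basis (Fin (β d)) k (V d)) := by
  obtain ⟨T, hT, hKT⟩ := exists_finite_span_sup_irrelevantIdeal_smul (k := k) hfg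
  let q := ((irrelevantIdeal k X • K).restrictScalars k).mkQ
  let W := (Submodule.span k T).map q
  have : Module.Finite k W := by
    rw [Module.Finite.iff_fg]
    exact (Submodule.fg_span hT).map q
  have hVW : ∀ d, ∀ v ∈ V d, q v ∈ W := fun d v hv => by
    obtain ⟨x, hx, y, hy, hxy⟩ := Submodule.mem_sup.1 (hKT (hV d hv).1)
    refine ⟨x, hx, ?_⟩
    rw [← hxy, map_add, left_eq_add]
    exact (Submodule.Quotient.mk_eq_zero _).2 hy
  have hfin : ∀ d, Module.Finite k (V d) := fun d => by
    refine Module.Finite.of_injective ((q ∘ₗ (V d).subtype).codRestrict W fun v => hVW d v v.2) ?_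
    refine (injective_iff_map_eq_zero _).2 fun v hv => ?_
    exact Subtype.ext (Submodule.disjoint_def.1 (hV' d) v v.2
      ((Submodule.Quotient.mk_eq_zero _).1 (congrArg W.subtype hv)))
  let b : ∀ d, Module.Basis (Fin (Module.finrank k (V d))) k (V d) :=
    fun d => Module.finBasis k (V d)
  refine ⟨fun d => Module.finrank k (V d), ?_, fun d hd => ?_, ⟨b⟩⟩
  · let w : ((d : ℤ) × Fin (Module.finrank k (V d))) → W := fun i =>
      ⟨q (b i.1 i.2), hVW i.1 _ (b i.1 i.2).2⟩
    have hw : LinearIndependent k w := by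
      rw [linearIndependent_iff]
      intro l hl
      refine GradedRep.IsStable.eq_zero_of_linearCombination_mem hV hV' hK ha b l ?_
      have h1 := congrArg W.subtype hl
      rw [map_zero, Finsupp.apply_linearCombination] at h1
      change Finsupp.linearCombination k (q ∘ fun i : (d : ℤ) × _ => (b i.1 i.2 : M)) l = 0 at h1
      rw [← Finsupp.apply_linearCombination] at h1
      exact (Submodule.Quotient.mk_eq_zero _).1 h1
    exact hw.finite
  · have : V d = ⊥ := by
      rw [eq_bot_iff]
      intro v hv
      rw [Submodule.mem_bot, ← S.proj_neg d v hd]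
      exact (hV d hv).2.symm
    change Module.finrank k (V d) = 0
    rw [this, finrank_bot]

end Cover

section Cover

variable {X : Type u} {k : Type v} [Field k] {G : Type w} [Group G]
  {a : G →* (MvPolynomial X k →ₐ[k] MvPolynomial X k)} {M : Type*}
    [AddCommGroup M] [Module (MvPolynomial X k) M] [Module k M]
    [IsScalarTower k (MvPolynomial X k) M] {S : GradedRep a M}
    {K : Submodule (MvPolynomial X k) M}

/-- A homogeneous stable submodule has an equivariant graded projective cover. -/
theorem GradedRep.IsStable.exists_cover [Finite G] [NeZero (Nat.card G : k)] (hK : S.IsStable K)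
    (hfg : K.FG) (ha : ∀ σ i, a σ (MvPolynomial.X i) ∈ irrelevantIdeal k X)
    (ha' : ∀ σ e r, a σ (homComp e r) = homComp e (a σ r)) :
    ∃ (β : ℤ → ℕ) (_ : Finite ((d : ℤ) × Fin (β d))) (T : GradedRep a (TwistedFree X k β))
      (f : TwistedFree X k β →ₗ[MvPolynomial X k] M),
      T.proj = twistedProj β ∧ LinearMap.range f = K ∧
      LinearMap.ker f ≤ irrelevantIdeal k X • ⊤ ∧ (∀ d h, f (T.proj d h) = S.proj d (f h)) ∧
      ∀ σ h, f (T.act σ h) = S.act σ (f h) := by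
  obtain ⟨V, hV, hKV, hVm, hact⟩ := hK.exists_generators ha
  obtain ⟨β, hfin, hβ, ⟨b⟩⟩ := GradedRep.IsStable.exists_basis hV hVm hK hfg ha
  let ρ : ∀ d, Representation k G (V d) := fun d =>
    (⟨V d, fun σ v hv => hact d σ v hv⟩ : Subrepresentation S.act).toRepresentation
  have hρ : ∀ d σ v, (ρ d σ v : M) = S.act σ v := fun d σ v => rfl
  let f : TwistedFree X k β →ₗ[MvPolynomial X k] M :=
    Finsupp.linearCombination (MvPolynomial X k) fun i => (b i.1 i.2 : M)
  have hf : ∀ i r, f (Finsupp.single i r) = r • (b i.1 i.2 : M) := fun i r =>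
    Finsupp.linearCombination_single ..
  have hfV : ∀ d v, f (twistedIncl b d v) = v := fun d v => by
    induction v using basis_induction (b d) with
    | zero => simp
    | add v w hv hw => simp only [map_add, hv, hw, Submodule.coe_add]
    | smul c v hv =>
      rw [map_smul, LinearMap.map_smul_of_tower, hv, Submodule.coe_smul]
    | basis j => rw [twistedIncl_basis, hf, one_smul]
  refine ⟨β, hfin, twistedRep b a ρ ha' hβ, f, rfl, ?_, ?_, ?_, ?_⟩
  · refine le_antisymm ?_ (hK.le_of_comp_le hKV hV fun d v hv => ⟨twistedIncl b d ⟨v, hv⟩, hfV _ _⟩)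
    rw [Finsupp.range_linearCombination, Submodule.span_le]
    rintro _ ⟨i, rfl⟩
    exact (hV _ (b i.1 i.2).2).1
  · intro h hh
    -- Let `h₀` be the vector of constant terms of `h`. As `f h = 0`, `f h₀ = -f (h - h₀)` lies in
    -- `𝔪K`; independence modulo `𝔪K` forces `h₀ = 0`, so `h` has all its entries in `𝔪`.
    let l : ((d : ℤ) × Fin (β d)) →₀ k := h.mapRange MvPolynomial.constantCoeff (map_zero _)
    let h₀ : TwistedFree X k β := l.mapRange MvPolynomial.C (map_zero _)
    have h1 : h - h₀ ∈ irrelevantIdeal k X • (⊤ : Submodule (MvPolynomial X k) _) := by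
      rw [← Finsupp.sum_single (h - h₀)]
      refine sum_mem fun i _ => ?_
      have : Finsupp.single i ((h - h₀) i) =
          ((h - h₀) i) • Finsupp.single i (1 : MvPolynomial X k) := by
        rw [Finsupp.smul_single, smul_eq_mul, mul_one]
      simp only [this]
      refine Submodule.smul_mem_smul ?_ Submodule.mem_top
      rw [Finsupp.sub_apply, Finsupp.mapRange_apply, Finsupp.mapRange_apply]
      exact sub_C_mem_irrelevantIdeal _
    have h2 : f h₀ = Finsupp.linearCombination k (fun i : (d : ℤ) × _ => (b i.1 i.2 : M)) l := by
      change Finsupp.linearCombination _ _ _ = _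
      rw [Finsupp.linearCombination_apply, Finsupp.linearCombination_apply]
      refine (Finsupp.sum_mapRange_index fun i => zero_smul (MvPolynomial X k)
        (b i.1 i.2 : M)).trans ?_
      refine Finsupp.sum_congr fun i _ => ?_
      rw [MvPolynomial.C_eq_smul_one, smul_assoc, one_smul]
    have h3 : f (h - h₀) ∈ irrelevantIdeal k X • K := by
      have h4 : f (h - h₀) ∈ (irrelevantIdeal k X • ⊤ : Submodule _ _).map f := ⟨_, h1, rfl⟩
      rw [Submodule.map_smul''] at h4
      refine Submodule.smul_mono le_rfl ?_ h4
      rw [Submodule.map_top, Finsupp.range_linearCombination, Submodule.span_le]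
      rintro _ ⟨i, rfl⟩
      exact (hV _ (b i.1 i.2).2).1
    have h4 : l = 0 := by
      refine GradedRep.IsStable.eq_zero_of_linearCombination_mem hV hVm hK ha b l ?_
      rw [← h2]
      rw [map_sub, LinearMap.mem_ker.1 hh, zero_sub] at h3
      exact neg_mem_iff.1 h3
    have h5 : h₀ = 0 := by ext1 i; simp [h₀, h4]
    rwa [h5, sub_zero] at h1
  · intro d h
    change f (twistedProj β d h) = _
    induction h using Finsupp.induction_linear with
    | zero => simp
    | add g h hg hh => simp only [map_add, hg, hh]
    | single i r => rw [twistedProj_single, hf, hf, S.proj_smul (hV _ (b i.1 i.2).2).2]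
  · intro σ h
    change f (twistedActLin b a ρ σ h) = _
    induction h using Finsupp.induction_linear with
    | zero => simp
    | add g h hg hh => simp only [map_add, hg, hh]
    | single i r => rw [twistedActLin_single, map_smul, hfV, hf, S.act_smul, hρ]

end Cover

/-! ### Symmetric minimal resolutions in good characteristic -/

section SymAction

variable {X : Type u} {I : AddSemigroupIdeal (X →₀ ℕ)}

/-- An element of `G_I` as an automorphism of the additive monoid `X →₀ ℕ`. -/
def symGroupAddEquiv (σ : symGroup I) : (X →₀ ℕ) ≃+ (X →₀ ℕ) where
  __ := (σ : Equiv.Perm (X →₀ ℕ))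
  map_add' := σ.2.1

/-- Variables are the atoms of the monoid: splitting a variable `y` off the image and pulling back
by `γ` writes `x` as a sum, and degree one leaves no room for a second nonzero summand. -/
theorem _root_.AddEquiv.exists_finsupp_single_eq (γ : (X →₀ ℕ) ≃+ (X →₀ ℕ)) (x : X) :
    ∃ y, γ (Finsupp.single x 1) = Finsupp.single y 1 := by
  classical
  have h1 : γ (Finsupp.single x 1) ≠ 0 := by simp
  obtain ⟨y, hy⟩ := Finsupp.support_nonempty_iff.2 h1
  refine ⟨y, ?_⟩
  have h2 : Finsupp.single y 1 ≤ γ (Finsupp.single x 1) := by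
    rw [Finsupp.single_le_iff]
    exact Nat.one_le_iff_ne_zero.2 (Finsupp.mem_support_iff.1 hy)
  obtain ⟨g, hg⟩ := exists_add_of_le h2
  have h3 : Finsupp.single x 1 = γ.symm (Finsupp.single y 1) + γ.symm g := by
    rw [← map_add, ← hg, AddEquiv.symm_apply_apply]
  have h4 := congrArg Finsupp.degree h3
  have h5 : (γ.symm (Finsupp.single y 1)).degree ≠ 0 := by
    rw [Ne, Finsupp.degree_eq_zero_iff]
    simp
  rw [map_add, Finsupp.degree_single] at h4
  have h6 : (γ.symm g).degree = 0 := by omega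
  rw [Finsupp.degree_eq_zero_iff, EmbeddingLike.map_eq_zero_iff] at h6
  rw [hg, h6, add_zero]

theorem _root_.AddEquiv.degree_finsupp (γ : (X →₀ ℕ) ≃+ (X →₀ ℕ)) (f : X →₀ ℕ) :
    (γ f).degree = f.degree := by
  have : (Finsupp.degree : (X →₀ ℕ) →+ ℕ).comp γ.toAddMonoidHom = Finsupp.degree := by
    refine Finsupp.addHom_ext' fun x => AddMonoidHom.ext_nat ?_
    obtain ⟨y, hy⟩ := γ.exists_finsupp_single_eq x
    simp [hy]
  exact DFunLike.congr_fun this f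

theorem degree_symGroup (σ : symGroup I) (f : X →₀ ℕ) :
    ((σ : Equiv.Perm (X →₀ ℕ)) f).degree = f.degree :=
  (symGroupAddEquiv σ).degree_finsupp f

/-- An automorphism is determined by the self-map of the finite set `X` that it induces on
variables. -/
instance [Finite X] : Finite (symGroup I) := by
  choose t ht using fun (σ : symGroup I) x => (symGroupAddEquiv σ).exists_finsupp_single_eq x
  refine Finite.of_injective t fun σ τ h => ?_
  have : (symGroupAddEquiv σ).toAddMonoidHom = (symGroupAddEquiv τ).toAddMonoidHom := by
    refine Finsupp.addHom_ext' fun x => AddMonoidHom.ext_nat ?_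
    simp [ht, h]
  refine Subtype.ext (Equiv.ext fun f => ?_)
  exact DFunLike.congr_fun this f

variable (k : Type v) [Field k]

/-- The action of an element of `G_I` on `k[X]`. -/
def symAlgHom (σ : symGroup I) : MvPolynomial X k →ₐ[k] MvPolynomial X k where
  __ := polyMap (1 : k ≃ₐ[k] k) (σ : Equiv.Perm (X →₀ ℕ))
  commutes' c := by simp [polyMap, MvPolynomial.algebraMap_eq]

variable {k}

theorem symAlgHom_monomial (σ : symGroup I) (f : X →₀ ℕ) (c : k) :
    symAlgHom k σ (MvPolynomial.monomial f c) =
      MvPolynomial.monomial ((σ : Equiv.Perm (X →₀ ℕ)) f) c :=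
  polyMap_monomial (1 : k ≃ₐ[k] k) _ σ.2.1 _ _

variable (I k) in
/-- The action of `G_I` on `k[X]`. -/
def symAct : symGroup I →* (MvPolynomial X k →ₐ[k] MvPolynomial X k) where
  toFun := symAlgHom k
  map_one' := by
    refine MvPolynomial.algHom_ext fun x => ?_
    rw [MvPolynomial.X, symAlgHom_monomial]
    rfl
  map_mul' σ τ := by
    refine MvPolynomial.algHom_ext fun x => ?_
    rw [MvPolynomial.X, AlgHom.mul_apply, symAlgHom_monomial, symAlgHom_monomial,
      symAlgHom_monomial]
    rfl

theorem symAct_monomial (σ : symGroup I) (f : X →₀ ℕ) (c : k) :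
    symAct I k σ (MvPolynomial.monomial f c) =
      MvPolynomial.monomial ((σ : Equiv.Perm (X →₀ ℕ)) f) c :=
  symAlgHom_monomial σ f c

theorem symAct_homComp (σ : symGroup I) (e : ℤ) (r : MvPolynomial X k) :
    symAct I k σ (homComp e r) = homComp e (symAct I k σ r) := by
  induction r using MvPolynomial.induction_on' with
  | monomial f c =>
    rw [symAct_monomial, homComp_monomial, homComp_monomial, degree_symGroup]
    split_ifs
    · rw [symAct_monomial]
    · rw [map_zero]
  | add p q hp hq => simp only [map_add, hp, hq]

theorem symAct_X_mem (σ : symGroup I) (i : X) :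
    symAct I k σ (MvPolynomial.X i) ∈ irrelevantIdeal k X := by
  obtain ⟨y, hy⟩ := (symGroupAddEquiv σ).exists_finsupp_single_eq i
  have h1 : symAct I k σ (MvPolynomial.X i) = MvPolynomial.X y :=
    (symAct_monomial σ _ 1).trans (congrArg (fun f => MvPolynomial.monomial f (1 : k)) hy)
  rw [h1]
  exact X_mem_irrelevantIdeal y

/-- The polynomial ring as a graded module with an action of `G_I`. -/
def polyRep : GradedRep (symAct I k) (MvPolynomial X k) where
  proj := homComp
  proj_proj d x := by rw [homComp_homComp, if_pos rfl]
  proj_ne d e x h := by rw [homComp_homComp, if_neg h]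
  proj_neg d x h := homComp_of_neg h x
  exists_sum x := by
    obtain ⟨s, hs⟩ := exists_sum_homComp x 0
    have := hs s subset_rfl
    simp only [sub_zero] at this
    exact ⟨s, this⟩
  proj_X_smul d i x := by
    rw [smul_eq_mul, smul_eq_mul, mul_comm, homComp_mul_X, mul_comm]
  act :=
    { toFun := fun σ => (symAct I k σ).toLinearMap
      map_one' := by rw [map_one]; rfl
      map_mul' := fun σ τ => by rw [map_mul]; rfl }
  act_smul σ r x := map_mul (symAct I k σ) r x
  act_proj σ d x := symAct_homComp σ d x

/-- Membership in a monomial ideal is tested on the support, which a projection only shrinks; `G_I`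
permutes the generating monomials. -/
theorem polyIdeal_isStable : (polyRep (I := I) (k := k)).IsStable (polyIdeal k I) where
  proj_mem d x hx := by
    change homComp d x ∈ _
    rw [polyIdeal, MvPolynomial.mem_ideal_span_monomial_image] at hx ⊢
    intro f hf
    refine hx f (MvPolynomial.mem_support_iff.2 fun h => MvPolynomial.mem_support_iff.1 hf ?_)
    rw [coeff_homComp, h, ite_self]
  act_mem σ x hx := by
    change symAct I k σ x ∈ _
    have : polyIdeal k I ≤ (polyIdeal k I).comap (symAct I k σ) := by
      refine Ideal.span_le.2 ?_
      rintro _ ⟨f, hf, rfl⟩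
      refine Ideal.subset_span ⟨_, (σ.2.2 f).2 hf, ?_⟩
      exact (symAct_monomial σ f 1).symm
    exact this hx

end SymAction

/-! ### Iterating equivariant covers -/

section Resolution

variable {X : Type u} {k : Type v} [Field k] {G : Type w} [Group G]

/-- A partial equivariant minimal resolution: its last module and the submodule of cycles. -/
structure ResStage (a : G →* (MvPolynomial X k →ₐ[k] MvPolynomial X k)) where
  /-- the graded Betti numbers of the last module -/
  β : ℤ → ℕ
  finite : Finite ((d : ℤ) × Fin (β d))
  /-- the grading and the action -/
  rep : GradedRep a (TwistedFree X k β)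
  proj_eq : rep.proj = twistedProj β
  /-- the submodule of cycles -/
  cycles : Submodule (MvPolynomial X k) (TwistedFree X k β)
  isStable : rep.IsStable cycles
  cycles_le : cycles ≤ irrelevantIdeal k X • ⊤

variable {a : G →* (MvPolynomial X k →ₐ[k] MvPolynomial X k)}

theorem ResStage.isHomogeneous_iff (s : ResStage a) (h : TwistedFree X k s.β) (e : ℤ) :
    h.IsHomogeneous e ↔ s.rep.proj e h = h := by
  rw [s.proj_eq, isHomogeneous_iff_twistedProj]

theorem GradedRep.isStable_ker {M N : Type*} [AddCommGroup M] [Module (MvPolynomial X k) M]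
    [Module k M] [IsScalarTower k (MvPolynomial X k) M] [AddCommGroup N]
    [Module (MvPolynomial X k) N] [Module k N] [IsScalarTower k (MvPolynomial X k) N]
    {S : GradedRep a M} {T : GradedRep a N} {f : M →ₗ[MvPolynomial X k] N}
    (h1 : ∀ d h, f (S.proj d h) = T.proj d (f h)) (h2 : ∀ σ h, f (S.act σ h) = T.act σ (f h)) :
    S.IsStable (LinearMap.ker f) where
  proj_mem d x hx := by
    rw [LinearMap.mem_ker] at hx ⊢
    rw [h1, hx, map_zero]
  act_mem d x hx := by
    rw [LinearMap.mem_ker] at hx ⊢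
    rw [h2, hx, map_zero]

theorem GradedRep.IsStable.exists_stage [Finite X] [Finite G] [NeZero (Nat.card G : k)]
    {M : Type*} [AddCommGroup M] [Module (MvPolynomial X k) M] [Module k M]
    [IsScalarTower k (MvPolynomial X k) M] [Module.Finite (MvPolynomial X k) M]
    {S : GradedRep a M} {K : Submodule (MvPolynomial X k) M} (hK : S.IsStable K)
    (ha : ∀ σ i, a σ (MvPolynomial.X i) ∈ irrelevantIdeal k X)
    (ha' : ∀ σ e r, a σ (homComp e r) = homComp e (a σ r)) :
    ∃ (s : ResStage a) (f : TwistedFree X k s.β →ₗ[MvPolynomial X k] M),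
      LinearMap.range f = K ∧ LinearMap.ker f = s.cycles ∧
      (∀ d h, f (s.rep.proj d h) = S.proj d (f h)) ∧ ∀ σ h, f (s.rep.act σ h) = S.act σ (f h) := by
  obtain ⟨β, hfin, T, f, h1, h2, h3, h4, h5⟩ :=
    hK.exists_cover (IsNoetherian.noetherian K) ha ha'
  exact ⟨⟨β, hfin, T, h1, _, GradedRep.isStable_ker h4 h5, h3⟩, f, h2, rfl, h4, h5⟩

end Resolution

/-- If the order of `G_I` is invertible in `k` then `I` has a symmetric minimal free resolution
over `k`. -/
theorem nonempty_symMinRes {X : Type u} [Finite X] (I : AddSemigroupIdeal (X →₀ ℕ)) {k : Type v}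
    [Field k] [NeZero (Nat.card (symGroup I) : k)] : Nonempty (SymMinRes k k I) := by
  have step : ∀ s : ResStage (symAct I k), ∃ (s' : ResStage (symAct I k))
      (f : TwistedFree X k s'.β →ₗ[MvPolynomial X k] TwistedFree X k s.β),
      LinearMap.range f = s.cycles ∧ LinearMap.ker f = s'.cycles ∧
      (∀ d h, f (s'.rep.proj d h) = s.rep.proj d (f h)) ∧
      ∀ σ h, f (s'.rep.act σ h) = s.rep.act σ (f h) := fun s =>
    have := s.finite
    s.isStable.exists_stage symAct_X_mem symAct_homComp
  choose next d hrange hker hproj hact using step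
  obtain ⟨s₀, f₀, hrange₀, hker₀, hproj₀, hact₀⟩ :=
    (polyIdeal_isStable (I := I) (k := k)).exists_stage symAct_X_mem symAct_homComp
  -- Stage `n + 1` covers the cycles of stage `n`; stage `0` covers `I k[X]`. Minimality of each
  -- differential is the bound on the cycles of its target.
  let s : ℕ → ResStage (symAct I k) := fun n => n.rec s₀ fun _ => next
  have hfin : ∀ n, Finite ((e : ℤ) × Fin ((s n).β e)) := fun n => (s n).finite
  -- The isomorphism induced by `f₀` is both graded and equivariant, so it serves as `ε` and as `δ`.
  let δ : (TwistedFree X k (s 0).β ⧸ LinearMap.range (d (s 0))) ≃ₗ[MvPolynomial X k]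
      polyIdeal k I :=
    (Submodule.quotEquivOfEq _ _ ((hrange (s 0)).trans hker₀.symm)).trans
      (f₀.quotKerEquivRange.trans (LinearEquiv.ofEq _ _ hrange₀))
  refine ⟨{
    fieldAct := 1
    M := fun n => TwistedFree X k (s n).β
    μ := fun n => d (s n)
    acyclic := fun n => LinearMap.exact_iff.2 ((hker (s n)).trans (hrange (s (n + 1))).symm)
    minimal := fun n => (hrange (s n)).trans_le (s n).cycles_le
    act :=
      { toFun := fun σ n => LinearEquiv.ofLinearMap ((s n).rep.act σ) ((s n).rep.act σ⁻¹)
          (by rw [← Module.End.mul_eq_comp, ← map_mul, mul_inv_cancel, map_one]; rfl)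
          (by rw [← Module.End.mul_eq_comp, ← map_mul, inv_mul_cancel, map_one]; rfl)
        map_one' := by
          ext1 n
          refine LinearEquiv.ext fun x => ?_
          exact LinearMap.congr_fun (map_one (s n).rep.act) x
        map_mul' := fun σ τ => by
          ext1 n
          refine LinearEquiv.ext fun x => ?_
          exact LinearMap.congr_fun (map_mul (s n).rep.act σ τ) x }
    act_comm := fun σ n x => hact (s n) σ x
    graded := by
      refine ⟨fun n => (s n).β, fun n => LinearEquiv.refl _ _, δ, fun n e h hh => ?_,
        fun e h hh => ?_⟩
      · exact ((s n).isHomogeneous_iff _ e).2 ((hproj (s n) e h).symm.trans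
          (congrArg (d (s n)) (((s (n + 1)).isHomogeneous_iff h e).1 hh)))
      · exact (isZHomogeneous_iff _ e).2 ((hproj₀ e h).symm.trans
          (congrArg f₀ (((s 0).isHomogeneous_iff h e).1 hh)))
    act_smul := fun σ n r x => (s n).rep.act_smul σ r x
    equivariant := ⟨δ, fun σ x => hact₀ σ x⟩ }⟩

/-! ### The number of matroidal splittings -/

section Splitting

variable {X : Type u} {I : AddSemigroupIdeal (X →₀ ℕ)} {F : Type v} [Field F] {a : X →₀ ℕ}

/-- The simplicial identity behind `d² = 0`. Conditions on values of indices avoid casts between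
`Fin` types. -/
theorem Face.remove_remove {n : ℕ} (c : Face I a (n + 2)) {i i' : Fin (n + 2)} {j j' : Fin (n + 1)}
    (hij : (j : ℕ) < i) (hi' : (i' : ℕ) = j) (hj' : (j' : ℕ) + 1 = i) :
    (c.remove i).remove j = (c.remove i').remove j' := by
  ext1
  funext l
  change c.vertex _ = c.vertex _
  congr 1
  simp only [Fin.ext_iff, Fin.succAbove, Fin.lt_def, Fin.val_castSucc]
  split_ifs <;> simp only [Fin.val_castSucc, Fin.val_succ] at * <;> omega

theorem relBd_single (n : ℕ) (c : Face I a (n + 1)) (r : F) :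
    relBd I F a (n + 1) (Finsupp.single c r) =
      ∑ i : Fin (n + 1), Finsupp.single (c.remove i) (r * (-1 : F) ^ (i : ℕ)) := by
  simp [relBd, Finset.smul_sum]

theorem relBd_relBd (n : ℕ) (x : RelChain I F a (n + 1)) :
    relBd I F a n (relBd I F a (n + 1) x) = 0 := by
  cases n with
  | zero => rfl
  | succ n =>
    induction x using Finsupp.induction_linear with
    | zero => simp
    | add f g hf hg => rw [map_add, map_add, hf, hg, add_zero]
    | single c r =>
      rw [relBd_single, map_sum]
      change ∑ i : Fin (n + 2), relBd I F a (n + 1) _ = 0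
      simp only [relBd_single]
      rw [← Finset.sum_product' (Finset.univ : Finset (Fin (n + 2)))
        (Finset.univ : Finset (Fin (n + 1)))
        (fun i j => Finsupp.single ((c.remove i).remove j)
          (r * (-1 : F) ^ (i : ℕ) * (-1 : F) ^ (j : ℕ)))]
      -- `g` exchanges the order in which two vertices are omitted: the face stays the same and the
      -- sign changes.
      let g : Fin (n + 2) × Fin (n + 1) → Fin (n + 2) × Fin (n + 1) := fun p =>
        if h : (p.2 : ℕ) < p.1 then (p.2.castSucc, ⟨p.1 - 1, by omega⟩)
        else (p.2.succ, ⟨p.1, by omega⟩)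
      refine Finset.sum_involution (fun p _ => g p) ?_ ?_ (fun _ _ => Finset.mem_univ _) ?_
      · rintro ⟨i, j⟩ -
        by_cases h : (j : ℕ) < i
        · simp only [g, dif_pos h]
          rw [c.remove_remove (i' := j.castSucc) (j' := ⟨i - 1, by omega⟩) h (by simp)
            (by simp only; omega), ← Finsupp.single_add]
          obtain ⟨m, hm⟩ : ∃ m, (i : ℕ) = m + 1 := ⟨i - 1, by omega⟩
          simp only [hm, Fin.val_castSucc, Nat.add_sub_cancel]
          rw [show r * (-1 : F) ^ (m + 1) * (-1) ^ (j : ℕ) + r * (-1) ^ (j : ℕ) * (-1) ^ m = 0 by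
            ring, Finsupp.single_zero]
        · simp only [g, dif_neg h]
          rw [c.remove_remove (i := j.succ) (i' := i) (j' := j) (by simp only [Fin.val_succ]; omega)
            rfl (by simp), ← Finsupp.single_add]
          rw [Fin.val_succ, show r * (-1 : F) ^ (i : ℕ) * (-1) ^ (j : ℕ) +
            r * (-1) ^ ((j : ℕ) + 1) * (-1) ^ (i : ℕ) = 0 by ring, Finsupp.single_zero]
      · rintro ⟨i, j⟩ - - h
        by_cases hij : (j : ℕ) < i <;> simp only [g, hij, dite_true, dite_false] at h <;>
          have h1 := congrArg (fun p : Fin (n + 2) × Fin (n + 1) => (p.1 : ℕ)) h <;>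
          simp only [Fin.val_castSucc, Fin.val_succ] at h1 <;> omega
      · rintro ⟨i, j⟩ -
        by_cases hij : (j : ℕ) < i
        · simp only [g, hij, dite_true]
          rw [dif_neg (by simp only [Fin.val_castSucc]; omega)]
          refine Prod.ext (Fin.ext ?_) (Fin.ext (by simp))
          simp only [Fin.val_succ]
          omega
        · simp only [g, hij, dite_false]
          rw [dif_pos (by simp only [Fin.val_succ]; omega)]
          exact Prod.ext (Fin.ext (by simp)) (Fin.ext (by simp))

variable (F) in
/-- The span of a set of elements of the canonical basis. -/
def faceSpan {n : ℕ} (Xn : Set (Face I a n)) : Submodule F (RelChain I F a n) :=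
  Submodule.span F ((fun c => Finsupp.single c (1 : F)) '' Xn)

/-- With `IsImageBasis.exists_mem`, this says that `d_n` maps the span of `Xn` isomorphically onto
`im d_n`. -/
theorem IsImageBasis.eq_zero {n : ℕ} {Xn : Set (Face I a n)} (hX : IsImageBasis (F := F) Xn)
    {x : RelChain I F a n} (hx : x ∈ faceSpan F Xn) (hd : relBd I F a n x = 0) : x = 0 := by
  have h1 := hX.1
  have h2 : x ∈ Finsupp.supported F F Xn := by
    rw [Finsupp.supported_eq_span_single]; exact hx
  refine linearIndepOn_iff.1 h1 x h2 ?_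
  rw [← hd]
  conv_rhs => rw [← Finsupp.sum_single x, Finsupp.sum, map_sum]
  rw [Finsupp.linearCombination_apply, Finsupp.sum]
  refine Finset.sum_congr rfl fun c _ => ?_
  rw [← map_smul, Finsupp.smul_single, smul_eq_mul, mul_one]

theorem IsImageBasis.exists_mem {n : ℕ} {Xn : Set (Face I a n)} (hX : IsImageBasis (F := F) Xn)
    (x : RelChain I F a n) : ∃ y ∈ faceSpan F Xn, relBd I F a n y = relBd I F a n x := by
  have h1 : relBd I F a n x ∈ LinearMap.range (relBd I F a n) := ⟨x, rfl⟩
  rw [← hX.2, ← Set.image_image (relBd I F a n), Submodule.span_image] at h1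
  exact h1

theorem exists_isImageBasis (n : ℕ) : ∃ Xn : Set (Face I a n), IsImageBasis (F := F) Xn := by
  obtain ⟨Xn, -, -, h1, h2⟩ := exists_linearIndepOn_extension
    (v := fun b : Face I a n => relBd I F a n (Finsupp.single b 1))
    (linearIndepOn_empty F _) (Set.empty_subset Set.univ)
  refine ⟨Xn, h2, le_antisymm (Submodule.span_le.2 ?_) ?_⟩
  · rintro _ ⟨b, -, rfl⟩
    exact ⟨_, rfl⟩
  · rintro _ ⟨x, rfl⟩
    induction x using Finsupp.induction_linear with
    | zero => simp
    | add f g hf hg => rw [map_add]; exact add_mem hf hg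
    | single c r =>
      rw [show Finsupp.single c r = r • Finsupp.single c (1 : F) by simp, map_smul]
      exact Submodule.smul_mem _ _ (h1 ⟨c, trivial, rfl⟩)

theorem fundCycles_subset_ker {n : ℕ} (Xn : Set (Face I a n)) :
    fundCycles F Xn ⊆ LinearMap.ker (relBd I F a n) := fun _ hz => hz.1

/-- Modulo the cycles `z(b)` every chain lies in the span of `Xn`, and that span contains no nonzero
cycle. -/
theorem IsImageBasis.span_fundCycles {n : ℕ} {Xn : Set (Face I a n)}
    (hX : IsImageBasis (F := F) Xn) :
    Submodule.span F (fundCycles F Xn) = LinearMap.ker (relBd I F a n) := by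
  refine le_antisymm (Submodule.span_le.2 (fundCycles_subset_ker Xn)) fun x hx => ?_
  have key : ∀ x : RelChain I F a n, x ∈ faceSpan F Xn ⊔ Submodule.span F (fundCycles F Xn) := by
    intro x
    induction x using Finsupp.induction_linear with
    | zero => exact zero_mem _
    | add f g hf hg => exact add_mem hf hg
    | single b r =>
      rw [show Finsupp.single b r = r • Finsupp.single b (1 : F) by simp]
      refine Submodule.smul_mem _ _ ?_
      by_cases hb : b ∈ Xn
      · exact Submodule.mem_sup_left (Submodule.subset_span ⟨b, hb, rfl⟩)
      · obtain ⟨y, hy, hyb⟩ := hX.exists_mem (Finsupp.single b 1)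
        rw [← add_sub_cancel y (Finsupp.single b 1)]
        refine Submodule.add_mem_sup hy (Submodule.subset_span ⟨?_, b, hb, ?_⟩)
        · rw [map_sub, hyb, sub_self]
        · rwa [sub_sub_cancel]
  obtain ⟨y, hy, z, hz, rfl⟩ := Submodule.mem_sup.1 (key x)
  have hz' : z ∈ LinearMap.ker (relBd I F a n) :=
    Submodule.span_le.2 (fundCycles_subset_ker Xn) hz
  rw [LinearMap.mem_ker, map_add, LinearMap.mem_ker.1 hz', add_zero] at hx
  rwa [hX.eq_zero hy hx, zero_add]

/-- The cycles `z(b)` span the kernel, so a basis of homology can be extracted from their classes.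
-/
theorem IsImageBasis.exists_isHomologyBasis {n : ℕ} {Xn : Set (Face I a n)}
    (hX : IsImageBasis (F := F) Xn) : ∃ Zn ⊆ fundCycles F Xn, IsHomologyBasis Zn := by
  obtain ⟨Zn, h0, -, h1, h2⟩ := exists_linearIndepOn_extension
    (v := (LinearMap.range (relBd I F a (n + 1))).mkQ)
    (linearIndepOn_empty F _) (Set.empty_subset (fundCycles F Xn))
  refine ⟨Zn, h0, h2, ?_⟩
  rw [← hX.span_fundCycles, ← Submodule.span_image]
  exact le_antisymm (Submodule.span_mono (Set.image_mono h0)) (Submodule.span_le.2 h1)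

theorem IsHomologyBasis.eq_zero {n : ℕ} {Zn : Set (RelChain I F a n)} (hZ : IsHomologyBasis Zn)
    {z : RelChain I F a n} (hz : z ∈ Submodule.span F Zn)
    (hz' : z ∈ LinearMap.range (relBd I F a (n + 1))) : z = 0 := by
  rw [← Set.image_id Zn, Finsupp.mem_span_image_iff_linearCombination] at hz
  obtain ⟨l, hl, rfl⟩ := hz
  have h1 := linearIndepOn_iff.1 hZ.1 l hl ?_
  · rw [h1, map_zero]
  · have := (Submodule.Quotient.mk_eq_zero _).2 hz'
    rw [← Submodule.mkQ_apply, Finsupp.apply_linearCombination] at this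
    exact this

/-- `C_n` is spanned by `Xₙ`, `Zₙ` and the boundaries of the elements of `Xₙ₊₁`. -/
theorem IsHomologyBasis.sup_eq_top {n : ℕ} {Xn : Set (Face I a n)} {Zn : Set (RelChain I F a n)}
    (hX : IsImageBasis (F := F) Xn) (hZ : IsHomologyBasis Zn) :
    faceSpan F Xn ⊔ Submodule.span F Zn ⊔ LinearMap.range (relBd I F a (n + 1)) = ⊤ := by
  refine eq_top_iff.2 fun x _ => ?_
  obtain ⟨y, hy, hyx⟩ := hX.exists_mem x
  have h1 : (LinearMap.range (relBd I F a (n + 1))).mkQ (x - y) ∈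
      (LinearMap.ker (relBd I F a n)).map (LinearMap.range (relBd I F a (n + 1))).mkQ :=
    ⟨x - y, by simp [hyx], rfl⟩
  rw [← hZ.2, Submodule.span_image] at h1
  obtain ⟨(z : RelChain I F a n), hz, hzx⟩ := h1
  have h2 := (Submodule.Quotient.eq _).1 hzx.symm
  rw [show x = y + z + (x - y - z) by abel]
  exact Submodule.add_mem_sup (Submodule.add_mem_sup hy hz) h2

/-- If `y + z` is a boundary, applying `d_n` kills the `Xn` part `y`; then `z` is a boundary and
vanishes by independence in homology. -/
theorem IsHomologyBasis.isCompl {n : ℕ} {Xn : Set (Face I a n)} {Zn : Set (RelChain I F a n)}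
    (hX : IsImageBasis (F := F) Xn) (hZX : Zn ⊆ fundCycles F Xn) (hZ : IsHomologyBasis Zn) :
    IsCompl (faceSpan F Xn ⊔ Submodule.span F Zn) (LinearMap.range (relBd I F a (n + 1))) := by
  refine IsCompl.of_eq ?_ (hZ.sup_eq_top hX)
  rw [eq_bot_iff]
  rintro _ ⟨hx, ⟨w, rfl⟩⟩
  obtain ⟨y, hy, z, hz, hyz⟩ := Submodule.mem_sup.1 hx
  have hz' : z ∈ LinearMap.ker (relBd I F a n) :=
    Submodule.span_le.2 (hZX.trans (fundCycles_subset_ker Xn)) hz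
  have h1 := congrArg (relBd I F a n) hyz
  rw [map_add, LinearMap.mem_ker.1 hz', add_zero, relBd_relBd] at h1
  rw [hX.eq_zero hy h1, zero_add] at hyz
  rw [Submodule.mem_bot, ← hyz]
  exact hZ.eq_zero hz ⟨w, hyz.symm⟩

theorem matroidalSplittings_nonempty (I : AddSemigroupIdeal (X →₀ ℕ)) (F : Type v) [Field F]
    (a : X →₀ ℕ) : (matroidalSplittings I F a).Nonempty := by
  choose Xs hX using fun n => exists_isImageBasis (I := I) (F := F) (a := a) n
  choose Zs hZX hZ using fun n => (hX n).exists_isHomologyBasis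
  have hD : ∀ n, ∃ D : RelChain I F a n →ₗ[F] RelChain I F a (n + 1),
      (∀ b ∈ Xs (n + 1), D (relBd I F a (n + 1) (Finsupp.single b 1)) = Finsupp.single b 1) ∧
      ∀ x ∈ faceSpan F (Xs n) ⊔ Submodule.span F (Zs n), D x = 0 := by
    intro n
    have hc := (hZ n).isCompl (hX n) (hZX n)
    let e : faceSpan F (Xs (n + 1)) ≃ₗ[F] LinearMap.range (relBd I F a (n + 1)) :=
      LinearEquiv.ofBijective ((relBd I F a (n + 1)).rangeRestrict ∘ₗ Submodule.subtype _) (by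
        constructor
        · refine (injective_iff_map_eq_zero _).2 fun x hx => Subtype.ext ?_
          exact (hX (n + 1)).eq_zero x.2 (congrArg Subtype.val hx)
        · rintro ⟨_, ⟨x, rfl⟩⟩
          obtain ⟨y, hy, hyx⟩ := (hX (n + 1)).exists_mem x
          exact ⟨⟨y, hy⟩, Subtype.ext hyx⟩)
    -- Project to the boundaries along the span of `X_n` and `Z_n`, then invert `d_{n+1}` on the
    -- span of `X_{n+1}`.
    let D := Submodule.subtype _ ∘ₗ e.symm.toLinearMap ∘ₗ Submodule.projectionOnto _ _ hc.symm
    refine ⟨D, fun b hb => ?_, fun x hx => ?_⟩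
    · let b' : faceSpan F (Xs (n + 1)) :=
        ⟨Finsupp.single b 1, Submodule.subset_span ⟨b, hb, rfl⟩⟩
      have h1 : Submodule.projectionOnto _ _ hc.symm
          (relBd I F a (n + 1) (Finsupp.single b 1)) = e b' :=
        Submodule.projectionOnto_apply_left hc.symm (e b')
      change ((e.symm (Submodule.projectionOnto _ _ hc.symm _) :
        faceSpan F (Xs (n + 1))) : RelChain I F a (n + 1)) = _
      rw [h1, LinearEquiv.symm_apply_apply]
    · change ((e.symm (Submodule.projectionOnto _ _ hc.symm _) :
        faceSpan F (Xs (n + 1))) : RelChain I F a (n + 1)) = _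
      rw [(Submodule.projectionOnto_apply_eq_zero_iff hc.symm).2 hx, map_zero]
      rfl
  choose D hD1 hD2 using hD
  refine ⟨D, Xs, Zs, hX, hZX, hZ, hD1, fun n b hb => hD2 n _ (Submodule.mem_sup_left
    (Submodule.subset_span ⟨b, hb, rfl⟩)), fun n z hz => hD2 n _ (Submodule.mem_sup_right
    (Submodule.subset_span hz))⟩

/-- The elements `b` of the canonical basis with `z(b)` in a given set of cycles. -/
def cycleFaces {n : ℕ} (Xn : Set (Face I a n)) (Zn : Set (RelChain I F a n)) : Set (Face I a n) :=
  {b | b ∉ Xn ∧ ∃ z ∈ Zn, Finsupp.single b 1 - z ∈ faceSpan F Xn}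

/-- The cycle `z(b)` is unique: two candidates for the same `b` differ by a cycle in the span of
`Xn`, which is zero. Hence `Zn` can be recovered from its faces. -/
theorem IsImageBasis.subset_of_cycleFaces_eq {n : ℕ} {Xn : Set (Face I a n)}
    (hX : IsImageBasis (F := F) Xn) {Zn Zn' : Set (RelChain I F a n)} (hZ : Zn ⊆ fundCycles F Xn)
    (hZ' : Zn' ⊆ fundCycles F Xn) (h : cycleFaces Xn Zn ⊆ cycleFaces Xn Zn') : Zn ⊆ Zn' := by
  intro z hz
  obtain ⟨hz0, b, hb, hbz⟩ := hZ hz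
  obtain ⟨-, z', hz', hbz'⟩ := h ⟨hb, z, hz, hbz⟩
  have h1 : z' - z ∈ faceSpan F Xn := by
    have := sub_mem (show _ ∈ faceSpan F Xn from hbz) hbz'
    rwa [sub_sub_sub_cancel_left] at this
  have h2 := hX.eq_zero h1 (by rw [map_sub, hz0, (hZ' hz').1, sub_zero])
  rwa [← sub_eq_zero.1 h2]

/-- Two splittings with the same sets of faces agree on a spanning set of every `C_n`. The bound
involves faces only, hence is uniform in `F`. -/
theorem finite_matroidalSplittings [Finite ((n : ℕ) × Face I a n)] :
    (matroidalSplittings I F a).Finite ∧ (matroidalSplittings I F a).ncard ≤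
      Nat.card (Set ((n : ℕ) × Face I a n) × Set ((n : ℕ) × Face I a n)) := by
  choose Xs Zs hX hZX hZ h1 h2 h3 using fun D : matroidalSplittings I F a => D.2
  let φ : matroidalSplittings I F a →
      Set ((n : ℕ) × Face I a n) × Set ((n : ℕ) × Face I a n) := fun D =>
    ({c | c.2 ∈ Xs D c.1}, {c | c.2 ∈ cycleFaces (Xs D c.1) (Zs D c.1)})
  have hsig : ∀ (A B : ∀ n, Set (Face I a n)),
      {c : (n : ℕ) × Face I a n | c.2 ∈ A c.1} = {c | c.2 ∈ B c.1} → A = B := fun A B h =>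
    funext fun n => Set.ext fun c => Set.ext_iff.1 h ⟨n, c⟩
  have hφ : Function.Injective φ := by
    intro D D' h
    have hXX : Xs D = Xs D' := hsig _ _ (congrArg Prod.fst h)
    have hBB := hsig (fun n => cycleFaces (Xs D n) (Zs D n))
      (fun n => cycleFaces (Xs D' n) (Zs D' n)) (congrArg Prod.snd h)
    refine Subtype.ext (funext fun n => ?_)
    have hBn : cycleFaces (Xs D n) (Zs D n) = cycleFaces (Xs D' n) (Zs D' n) := congrFun hBB n
    have hZZ : Zs D n = Zs D' n := by
      have hZ1 := hZX D n
      have hX1 := hX D n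
      rw [hXX] at hBn hZ1 hX1
      exact (hX1.subset_of_cycleFaces_eq hZ1 (hZX D' n) hBn.subset).antisymm
        (hX1.subset_of_cycleFaces_eq (hZX D' n) hZ1 hBn.superset)
    have hle : faceSpan F (Xs D n) ⊔ Submodule.span F (Zs D n) ⊔
        LinearMap.range (relBd I F a (n + 1)) ≤ LinearMap.eqLocus (D.1 n) (D'.1 n) := by
      refine sup_le (sup_le ?_ ?_) ?_
      · refine Submodule.span_le.2 ?_
        rintro _ ⟨b, hb, rfl⟩
        exact (h2 D n b hb).trans (h2 D' n b (hXX ▸ hb)).symm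
      · refine Submodule.span_le.2 fun z hz => ?_
        exact (h3 D n z hz).trans (h3 D' n z (hZZ ▸ hz)).symm
      · rw [← (hX D (n + 1)).2]
        refine Submodule.span_le.2 ?_
        rintro _ ⟨b, hb, rfl⟩
        exact (h1 D n b hb).trans (h1 D' n b (hXX ▸ hb)).symm
    rw [(hZ D n).sup_eq_top (hX D n)] at hle
    exact LinearMap.ext fun x => hle Submodule.mem_top
  have : Finite (matroidalSplittings I F a) := Finite.of_injective φ hφ
  exact ⟨Set.toFinite _, Nat.card_le_card_of_injective φ hφ⟩

end Splitting

/-! ### Finiteness of the lcm-lattice and of its chains -/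

section Finiteness

variable {X : Type u} [Finite X] (I : AddSemigroupIdeal (X →₀ ℕ))

/-- Dickson's lemma: minimal elements form an antichain in a well-quasi-order. -/
theorem finite_minGens : (minGens I).Finite :=
  (setOfPred_minimal_antichain _).finite_of_partiallyWellOrderedOn
    (Set.isPWO_of_wellQuasiOrderedLE _)

theorem finite_lcmLattice' : (lcmLattice' I).Finite := by
  refine Set.Finite.subset (Set.Finite.image (fun S : Finset (X →₀ ℕ) => S.sup id)
    ((finite_minGens I).finite_subsets.preimage Finset.coe_injective.injOn)) ?_
  rintro _ ⟨⟨S, hS, rfl⟩, -⟩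
  exact ⟨S, hS, rfl⟩

instance (a : X →₀ ℕ) : Finite ((n : ℕ) × Face I a n) := by
  have hL : Finite (lcmLattice' I) := finite_lcmLattice' I
  let vert : ∀ {n}, Face I a n → Fin (n + 1) → lcmLattice' I := fun c i => ⟨c.vertex i, c.mem i⟩
  -- An `n`-face has `n + 1` distinct vertices, which bounds the dimension and leaves finitely many
  -- faces in all.
  have hn : ∀ {n} (c : Face I a n), n < Nat.card (lcmLattice' I) := fun {n} c => by
    have := Nat.card_le_card_of_injective (vert c) fun i j h =>
      c.strictMono.injective (congrArg Subtype.val h)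
    rwa [Nat.card_fin] at this
  let ψ : ((n : ℕ) × Face I a n) →
      (n : Fin (Nat.card (lcmLattice' I))) × (Fin (n + 1) → lcmLattice' I) :=
    fun c => ⟨⟨c.1, hn c.2⟩, vert c.2⟩
  refine Finite.of_injective ψ ?_
  rintro ⟨n, c⟩ ⟨m, c'⟩ h
  obtain rfl : n = m := congrArg (fun p => (p.1 : ℕ)) h
  have h' := eq_of_heq (Sigma.mk.inj h).2
  congr 1
  ext1
  funext i
  exact congrArg Subtype.val (congrFun h' i)

end Finiteness

end

end MonomialRes

theorem corollaryC {X : Type u} [Finite X] (I : AddSemigroupIdeal (X →₀ ℕ)) :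
    ∃ N : ℕ, ∀ (p : ℕ) [Fact p.Prime], N ≤ p →
      Nonempty (MonomialRes.SymMinRes (ZMod p) (ZMod p) I) ∧
      ∀ a ∈ MonomialRes.lcmLattice' I,
        MonomialRes.matroidalCount (ZMod p) I a < p ∧
        ¬ MonomialRes.IsCritical (ZMod p) I a := by
  -- `B` can be fixed before `p`, since the bound on the count does not depend on the field.
  obtain ⟨B, hB⟩ := ((MonomialRes.finite_lcmLattice' I).image fun a =>
    Nat.card (Set ((n : ℕ) × MonomialRes.Face I a n) ×
      Set ((n : ℕ) × MonomialRes.Face I a n))).bddAbove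
  refine ⟨max (Nat.card (MonomialRes.symGroup I)) B + 1, fun p _ hp => ⟨?_, fun a ha => ?_⟩⟩
  · have : NeZero (Nat.card (MonomialRes.symGroup I) : ZMod p) := by
      refine ⟨fun h => ?_⟩
      rw [ZMod.natCast_eq_zero_iff] at h
      have := Nat.le_of_dvd Nat.card_pos h
      omega
    exact MonomialRes.nonempty_symMinRes I
  · obtain ⟨h1, h2⟩ := MonomialRes.finite_matroidalSplittings (I := I)
      (F := (⊥ : Subfield (ZMod p))) (a := a)
    have h3 : MonomialRes.matroidalCount (ZMod p) I a < p :=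
      (h2.trans (hB ⟨a, ha, rfl⟩)).trans_lt (by omega)
    refine ⟨h3, fun h => ?_⟩
    rw [MonomialRes.IsCritical, ZMod.ringChar_zmod_n] at h
    -- Positivity is essential: every prime divides `0`.
    have h4 : 0 < MonomialRes.matroidalCount (ZMod p) I a :=
      (Set.ncard_pos h1).2 (MonomialRes.matroidalSplittings_nonempty I _ a)
    exact absurd (Nat.le_of_dvd h4 h) (not_le.2 h3)
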